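/- **Setting.** Let $r\ge 2$ and $n\ge 1$ be integers, $\kappa\neq 0$ an integer (the value $\mathbf Q(\alpha)$ of the metaplectic quadratic form on the roots), $m:=n/\gcd(n,\kappa)$, and $\epsilon\in\{\pm1\}$ a sign. Let $\mathbb F=\mathbb C(q,k)$ and let $\mathbb K^{(n)}=\mathbb F(g_j : 1\le j<n/2)$ be the field of rational functions over $\mathbb F$ in the variables $g_j$. Define $g_s\in\mathbb K^{(n)}$ for all $s\in\mathbb Z$ by $g_{s+n}=g_s$, $g_0=-1$, $g_{n/2}=\epsilon^{-1}k^{-1}$ if $n$ is even, and $g_s=k^{-2}g_{n-s}^{-1}$ for $n/2<s<n$. Let $\mathbb K^{(n,\kappa)}\subseteq\mathbb K^{(n)}$ be the subfield generated over $\mathbb F$ by all $g_{\kappa j}$, $j\in\mathbb Z$, and let $\mathbb K^{(n,\kappa)}[x^{\pm1}]$ be the Laurent polynomials in $x_1,\dots,x_r$, with monomials $x^\mu$, $\mu\in\mathbb Z^r$. Let $\epsilon_1,\dots,\epsilon_r$ be the standard basis of $\mathbb Z^r$ with the standard inner product $(\cdot,\cdot)$, $\alpha_i=\epsilon_i-\epsilon_{i+1}$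 for $1\le i<r$, $\theta=\epsilon_1-\epsilon_r$, and let $s_i$, $s_\theta$ be the corresponding reflections. For $1\le i<r$ put $s_i\lambda=\lambda-(\lambda,\alpha_i)\alpha_i$ and $x^{b_i}=x^{m\alpha_i}$; further put $$x^{s_0\lambda}:=q^{m(\lambda,\theta)}x^{s_\theta\lambda},\qquad x^{b_0}:=q^{m^2}x^{-m\theta},\qquad x^{\omega\lambda}:=q^{-m\lambda_r}x^{(\lambda_r,\lambda_1,\dots,\lambda_{r-1})}.$$ **The algebra.** The double affine Hecke algebra $\mathbb H^{(m)}$ is the unital associative $\mathbb F$-algebra generated by $T_0,\dots,T_{r-1}$, $\omega^{\pm1}$ and $x^\nu$ ($\nu\in m\mathbb Z^r$) with relations: $\omega\omega^{-1}=1=\omega^{-1}\omega$; $x^0=1$, $x^{\nu}x^{\nu'}=x^{\nu+\nu'}$; $(T_j-k)(T_j+k^{-1})=0$; the braid relations of type $\widehat A_{r-1}$ for $T_0,\dots,T_{r-1}$ (indices modulo $r$; none if $r=2$); $\omega T_j=T_{j+1}\omega$ (indices modulo $r$); and, for $\nu\in m\mathbb Z^r$ and $0\le j<r$, $$T_jx^\nu-x^{s_j\nu}T_j=(k-k^{-1})\frac{x^\nu-x^{s_j\nu}}{1-x^{b_j}},\qquad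 \omega x^\nu=x^{\omega\nu}\omega.$$ Put $Y^{m\epsilon_i}:=T_{i-1}^{-1}\cdots T_1^{-1}\,\omega\,T_{r-1}\cdots T_i$ for $1\le i\le r$, and $Y^\lambda:=\prod_{i=1}^r(Y^{m\epsilon_i})^{\lambda_i/m}$ for $\lambda\in m\mathbb Z^r$. **The representation.** For $s\in\mathbb Z$ let $t(s)=m\lfloor s/m\rfloor$. The metaplectic basic representation $\widehat\pi=\widehat\pi^{(n,\kappa)}$ of $\mathbb H^{(m)}$ on $\mathbb K^{(n,\kappa)}[x^{\pm1}]$ is given by $\mathbb K^{(n,\kappa)}$-linear operators: $\widehat\pi(x^\nu)$ is multiplication by $x^\nu$, $\widehat\pi(\omega)x^\lambda=x^{\omega\lambda}$, and for $\lambda\in\mathbb Z^r$, $1\le i<r$, $$\widehat\pi(T_i)x^\lambda=(k-k^{-1})\frac{1-x^{-t((\lambda,\alpha_i))\alpha_i}}{1-x^{m\alpha_i}}\,x^\lambda-k\,g_{-\kappa(\lambda,\alpha_i)}\,x^{s_i\lambda},$$ $$\widehat\pi(T_0)x^\lambda=(k-k^{-1})\frac{1-q^{-m\,t(-(\lambda,\theta))}x^{t(-(\lambda,\theta))\theta}}{1-q^{m^2}x^{-m\theta}}\,x^\lambda-k\,g_{\kappa(\lambda,\theta)}\,q^{m(\lambda,\theta)}x^{s_\theta\lambda}.$$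 **The eigenvalues.** Let $\sigma(s)=k^{-1}$ if $s\in m\mathbb Z_{>0}$ and $\sigma(s)=-k\,g_{-\kappa s}$ for all other $s\in\mathbb Z$. For $\mu\in\mathbb Z^r$ and $\lambda\in m\mathbb Z^r$ put $$\gamma_\mu^\lambda:=q^{-(\lambda,\mu)}\prod_{1\le i<j\le r}\sigma(\mu_i-\mu_j)^{(\lambda_i-\lambda_j)/m}\in\mathbb K^{(n,\kappa)}.$$ **Theorem.** There is a unique family of Laurent polynomials $\{E_\mu\}_{\mu\in\mathbb Z^r}$ in $\mathbb K^{(n,\kappa)}[x^{\pm1}]$ such that for every $\mu\in\mathbb Z^r$: (i) $\widehat\pi(Y^\lambda)E_\mu=\gamma_\mu^\lambda\,E_\mu$ for all $\lambda\in m\mathbb Z^r$; (ii) the coefficient of $x^\mu$ in the expansion of $E_\mu$ in the monomial basis is $1$. -/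

import Mathlib

namespace Metaplectic

set_option linter.unusedSectionVars false

/-! The fields, the operators on Laurent polynomials, and the double affine Hecke algebra. -/

/-- The finite geometric sum that equals `(1 - z^{-u}) / (1 - z) • y` when `Z i = z^i • y`:
it is `∑_{0 ≤ i < -u} Z i` for `u < 0` and `-∑_{-u ≤ i < 0} Z i` for `u ≥ 0`. -/
def geomSum {M : Type*} [AddCommGroup M] (Z : ℤ → M) (u : ℤ) : M :=
  if 0 ≤ u then -∑ i ∈ Finset.range u.toNat, Z (-(i + 1 : ℤ))
  else ∑ i ∈ Finset.range (-u).toNat, Z i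

/-- With `S` the operator `z`: `(1 - z) (geomSum Z u) = Z 0 - Z (-u)`. -/
theorem geomSum_spec {M : Type*} [AddCommGroup M] (Z : ℤ → M) (S : M →+ M)
    (hS : ∀ i, S (Z i) = Z (i + 1)) (u : ℤ) :
    geomSum Z u - S (geomSum Z u) = Z 0 - Z (-u) := by
  unfold geomSum
  split_ifs with hu
  · obtain ⟨n, rfl⟩ := Int.eq_ofNat_of_zero_le hu
    have h := Finset.sum_range_sub (fun i : ℕ => Z (-(i : ℤ))) n
    simp only [Finset.sum_sub_distrib] at h
    have h2 : ∀ i : ℕ, S (Z (-(i + 1 : ℤ))) = Z (-(i : ℤ)) := fun i => by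
      rw [hS]; congr 1; ring
    simp only [map_neg, map_sum, h2, Int.toNat_natCast]
    push_cast at h
    simp only [neg_zero] at h
    rw [← neg_sub (Z (-(n : ℤ))), ← h]; abel
  · obtain ⟨n, hn⟩ := Int.eq_ofNat_of_zero_le (a := -u) (by lia)
    obtain rfl : u = -(n : ℤ) := by lia
    have h := Finset.sum_range_sub (fun i : ℕ => Z (i : ℤ)) n
    simp only [Finset.sum_sub_distrib] at h
    simp only [map_sum, hS, neg_neg, Int.toNat_natCast]
    simp only [Nat.cast_add, Nat.cast_one, Nat.cast_zero] at h
    rw [← neg_sub (Z (n : ℤ)), ← h]; abel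


/-- The field `𝔽 = ℂ(q, k)` of rational functions in two variables. -/
def BaseField : Type := FractionRing (MvPolynomial (Fin 2) ℂ)

noncomputable instance : Field BaseField :=
  inferInstanceAs (Field (FractionRing (MvPolynomial (Fin 2) ℂ)))

noncomputable instance : Algebra (MvPolynomial (Fin 2) ℂ) BaseField :=
  inferInstanceAs (Algebra (MvPolynomial (Fin 2) ℂ) (FractionRing (MvPolynomial (Fin 2) ℂ)))

instance : IsFractionRing (MvPolynomial (Fin 2) ℂ) BaseField :=
  inferInstanceAs (IsFractionRing (MvPolynomial (Fin 2) ℂ)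
    (FractionRing (MvPolynomial (Fin 2) ℂ)))

/-- The variable `q` of `𝔽 = ℂ(q, k)`. -/
noncomputable def qVar : BaseField :=
  algebraMap (MvPolynomial (Fin 2) ℂ) BaseField (MvPolynomial.X 0)

/-- The variable `k` of `𝔽 = ℂ(q, k)`. -/
noncomputable def kVar : BaseField :=
  algebraMap (MvPolynomial (Fin 2) ℂ) BaseField (MvPolynomial.X 1)

/-- The field `𝕂⁽ⁿ⁾ = 𝔽(g_j : 1 ≤ j < n / 2)`. -/
def BigField (n : ℕ) : Type :=
  FractionRing (MvPolynomial {j : ℕ // 1 ≤ j ∧ 2 * j < n} BaseField)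

noncomputable instance (n : ℕ) : Field (BigField n) :=
  inferInstanceAs (Field (FractionRing (MvPolynomial {j : ℕ // 1 ≤ j ∧ 2 * j < n} BaseField)))

noncomputable instance (n : ℕ) : Algebra BaseField (BigField n) :=
  inferInstanceAs (Algebra BaseField
    (FractionRing (MvPolynomial {j : ℕ // 1 ≤ j ∧ 2 * j < n} BaseField)))

noncomputable instance (n : ℕ) :
    Algebra (MvPolynomial {j : ℕ // 1 ≤ j ∧ 2 * j < n} BaseField) (BigField n) :=
  inferInstanceAs (Algebra (MvPolynomial {j : ℕ // 1 ≤ j ∧ 2 * j < n} BaseField)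
    (FractionRing (MvPolynomial {j : ℕ // 1 ≤ j ∧ 2 * j < n} BaseField)))

instance (n : ℕ) :
    IsFractionRing (MvPolynomial {j : ℕ // 1 ≤ j ∧ 2 * j < n} BaseField) (BigField n) :=
  inferInstanceAs (IsFractionRing (MvPolynomial {j : ℕ // 1 ≤ j ∧ 2 * j < n} BaseField)
    (FractionRing (MvPolynomial {j : ℕ // 1 ≤ j ∧ 2 * j < n} BaseField)))

instance (n : ℕ) :
    IsScalarTower BaseField (MvPolynomial {j : ℕ // 1 ≤ j ∧ 2 * j < n} BaseField) (BigField n) :=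
  inferInstanceAs (IsScalarTower BaseField (MvPolynomial {j : ℕ // 1 ≤ j ∧ 2 * j < n} BaseField)
    (FractionRing (MvPolynomial {j : ℕ // 1 ≤ j ∧ 2 * j < n} BaseField)))

/-- The variable `g_j` of `𝕂⁽ⁿ⁾`, for `1 ≤ j < n / 2` (the other values are never used). -/
noncomputable def gVar (n j : ℕ) : BigField n :=
  if h : 1 ≤ j ∧ 2 * j < n then
    algebraMap (MvPolynomial {j : ℕ // 1 ≤ j ∧ 2 * j < n} BaseField) (BigField n)
      (MvPolynomial.X ⟨j, h⟩)
  else 0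

/-- The representation parameters `g_s⁽ⁿ⁾`, `s ∈ ℤ`: they depend only on `s` modulo `n`, and with
`j ∈ {0, …, n - 1}` the remainder of `s`, they are `-1` for `j = 0`, the variable `g_j` for
`0 < j < n / 2`, `ε⁻¹ k⁻¹` for `j = n / 2`, and `k⁻² (g_{n - j})⁻¹` for `n / 2 < j < n`. -/
noncomputable def gParam (n : ℕ) (ε : ℤˣ) (s : ℤ) : BigField n :=
  let j : ℕ := (s % n).toNat
  if j = 0 then -1
  else if 2 * j < n then gVar n j
  else if 2 * j = n then
    (((ε⁻¹ : ℤˣ) : ℤ) : BigField n) * (algebraMap BaseField (BigField n) kVar)⁻¹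
  else ((algebraMap BaseField (BigField n) kVar) ^ 2)⁻¹ * (gVar n (n - j))⁻¹

/-- `m = n / gcd(n, κ)`. -/
def mNum (n : ℕ) (κ : ℤ) : ℕ := n / Int.gcd n κ

/-- The subfield `𝕂^(n,κ)` of `𝕂⁽ⁿ⁾`, generated over `𝔽` by the `g_{κ j}⁽ⁿ⁾`, `j ∈ ℤ`
(the image of the field `𝕂⁽ᵐ⁾` under the map that sends `g_j⁽ᵐ⁾` to `g_{κ j}⁽ⁿ⁾`). -/
noncomputable def paramSubfield (n : ℕ) (κ : ℤ) (ε : ℤˣ) :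
    IntermediateField BaseField (BigField n) :=
  IntermediateField.adjoin BaseField (Set.range fun j : ℤ => gParam n ε (κ * j))

/-- The subfield `𝕂^(n,κ)`, as a type. -/
def ParamField (n : ℕ) (κ : ℤ) (ε : ℤˣ) : Type := paramSubfield n κ ε

noncomputable instance (n : ℕ) (κ : ℤ) (ε : ℤˣ) : Field (ParamField n κ ε) :=
  inferInstanceAs (Field (paramSubfield n κ ε))

noncomputable instance (n : ℕ) (κ : ℤ) (ε : ℤˣ) : Algebra BaseField (ParamField n κ ε) :=
  inferInstanceAs (Algebra BaseField (paramSubfield n κ ε))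

/-- The representation parameter `g_{κ s}⁽ⁿ⁾`, as an element of `𝕂^(n,κ)`. -/
noncomputable def gSub (n : ℕ) (κ : ℤ) (ε : ℤˣ) (s : ℤ) : ParamField n κ ε :=
  (⟨gParam n ε (κ * s), IntermediateField.subset_adjoin _ _ ⟨s, rfl⟩⟩ : paramSubfield n κ ε)

/-- `q` in the field `K`. -/
noncomputable def qIn (K : Type*) [Field K] [Algebra BaseField K] : K := algebraMap BaseField K qVar

/-- `k` in the field `K`. -/
noncomputable def kIn (K : Type*) [Field K] [Algebra BaseField K] : K := algebraMap BaseField K kVar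

/-- The multiplicity function: `p_j^(n,κ)(λ) = -k g_{-κ s}` where `s = (λ, a_j)`. -/
noncomputable def multP (n : ℕ) (κ : ℤ) (ε : ℤˣ) (s : ℤ) : ParamField n κ ε :=
  -kIn _ * gSub n κ ε (-s)

/-- Laurent polynomials in `r` variables over `K`: the group algebra of `ℤ^r`. -/
abbrev Laurent (K : Type*) [Field K] (r : ℕ) : Type _ := AddMonoidAlgebra K (Fin r → ℤ)

/-- Affine weights `(v, c)`, in `ℤ^r ⊕ ℤ`. -/
abbrev AffWeight (r : ℕ) : Type := (Fin r → ℤ) × ℤ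

/-- The monomial `x^{(v, c)} = q^c x^v`. -/
noncomputable def mono {K : Type*} [Field K] {r : ℕ} (q : K) (w : AffWeight r) : Laurent K r :=
  AddMonoidAlgebra.single w.1 (q ^ w.2)

/-- The linear operator with given values on the monomials `x^v`. -/
noncomputable def linExt {K : Type*} [Field K] {r : ℕ} (f : (Fin r → ℤ) → Laurent K r) :
    Laurent K r →ₗ[K] Laurent K r :=
  (AddMonoidAlgebra.basis (Fin r → ℤ) K).constr K f

section Roots
variable {r : ℕ} [NeZero r]

/-- The affine root `b_j / m`. The coordinates are numbered `0, …, r - 1`, and indices are taken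
modulo `r`: for `j ≠ 0` this is the simple root `α_j = e_{j-1} - e_j` (and level `0`), and for
`j = 0` it is `(-θ, m)` with `-θ = e_{r-1} - e_0`. -/
def simpleRoot (m : ℕ) (j : Fin r) : AffWeight r :=
  (Pi.single (j - 1) 1 - Pi.single j 1, if j = 0 then (m : ℤ) else 0)

/-- The pairing of `v` with the finite part of `simpleRoot m j`: it is `(v, α_j^∨)` for `j ≠ 0`
and `-(v, θ^∨)` for `j = 0`. -/
def pair (j : Fin r) (v : Fin r → ℤ) : ℤ := v (j - 1) - v j

/-- The affine reflection `s_j⁽ᵐ⁾` on affine weights. -/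
def reflect (m : ℕ) (j : Fin r) (w : AffWeight r) : AffWeight r := w - pair j w.1 • simpleRoot m j

/-- The action of `ω⁽ᵐ⁾` on affine weights: a cyclic permutation of the coordinates, and `c`
becomes `c - m v_r` (`v_r` is the last coordinate, here `w.1 (-1)`). -/
def omegaAct (m : ℕ) (w : AffWeight r) : AffWeight r :=
  (fun i => w.1 (i - 1), w.2 - m * w.1 (-1))

/-- The inverse of `omegaAct`. -/
def omegaInvAct (m : ℕ) (w : AffWeight r) : AffWeight r :=
  (fun i => w.1 (i + 1), w.2 + m * w.1 0)

/-- The operator of `T_j` on Laurent polynomials: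
`x^v ↦ (k - k⁻¹) (1 - x^{-t a_j}) / (1 - x^{m a_j}) x^v + p((v, a_j)) x^{s_j v}`
where `a_j = simpleRoot m j`, `t = (v, a_j) - ((v, a_j) mod m) = m ⌊(v, a_j) / m⌋`. -/
noncomputable def opT {K : Type*} [Field K] (q k : K) (m : ℕ) (p : ℤ → K) (j : Fin r) :
    Laurent K r →ₗ[K] Laurent K r :=
  linExt fun v =>
    (k - k⁻¹) • geomSum (fun i : ℤ => mono q ((v, 0) + (i * m) • simpleRoot m j)) (pair j v / m)
      + p (pair j v) • mono q (reflect m j (v, 0))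

/-- The operator of `ω`: `x^v ↦ x^{ω v}`. -/
noncomputable def opOmega {K : Type*} [Field K] (q : K) (m : ℕ) :
    Laurent K r →ₗ[K] Laurent K r :=
  linExt fun v => mono q (omegaAct m (v, 0))

/-- The inverse of the operator of `ω`. -/
noncomputable def opOmegaInv {K : Type*} [Field K] (q : K) (m : ℕ) :
    Laurent K r →ₗ[K] Laurent K r :=
  linExt fun v => mono q (omegaInvAct m (v, 0))

/-- The operator of `x^{m ν}`: multiplication by `x^{m ν}`. -/
noncomputable def opX {K : Type*} [Field K] (m : ℕ) (ν : Fin r → ℤ) :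
    Laurent K r →ₗ[K] Laurent K r :=
  LinearMap.mulLeft K (AddMonoidAlgebra.single ((m : ℤ) • ν) 1)

end Roots

section Daha

/-- Generators of the double affine Hecke algebra; `X ν` stands for `x^{m ν}`. -/
inductive Gen (r : ℕ) : Type
  | T (j : Fin r)
  | om
  | omInv
  | X (ν : Fin r → ℤ)

variable {r : ℕ} [NeZero r]

/-- The generator `T_j` in the free algebra. -/
noncomputable abbrev fT (j : Fin r) : FreeAlgebra BaseField (Gen r) := FreeAlgebra.ι _ (Gen.T j)

/-- The generator `ω` in the free algebra. -/
noncomputable abbrev fOm : FreeAlgebra BaseField (Gen r) := FreeAlgebra.ι _ Gen.om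

/-- The generator `ω⁻¹` in the free algebra. -/
noncomputable abbrev fOmInv : FreeAlgebra BaseField (Gen r) := FreeAlgebra.ι _ Gen.omInv

/-- `q^c x^{m ν}` in the free algebra, for `w = (ν, c)`. -/
noncomputable def fX (w : AffWeight r) : FreeAlgebra BaseField (Gen r) :=
  qVar ^ w.2 • FreeAlgebra.ι _ (Gen.X w.1)

/-- `x^{b_j} = q^c x^{m ν}` with `(ν, c) = bRoot m j`, so `(ν, c) = (-θ, m ^ 2)` for `j = 0` and
`(ν, c) = (α_j, 0)` for `j ≠ 0`. -/
def bRoot (m : ℕ) (j : Fin r) : AffWeight r := ((simpleRoot m j).1, m * (simpleRoot m j).2)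

/-- The defining relations of the `GL_r` double affine Hecke algebra `ℍ⁽ᵐ⁾` (indices modulo `r`).
In the cross relation, `s_j(m ν) = m ν - (ν, a_j) b_j`, and the quotient
`(x^{m ν} - x^{s_j (m ν)}) / (1 - x^{b_j})` is the displayed finite geometric sum. -/
inductive DahaRel (r : ℕ) [NeZero r] (m : ℕ) :
    FreeAlgebra BaseField (Gen r) → FreeAlgebra BaseField (Gen r) → Prop
  | braid (hr : 3 ≤ r) (j : Fin r) :
      DahaRel r m (fT j * fT (j + 1) * fT j) (fT (j + 1) * fT j * fT (j + 1))
  | comm (i j : Fin r) (h₁ : i ≠ j) (h₂ : i ≠ j + 1) (h₃ : j ≠ i + 1) :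
      DahaRel r m (fT i * fT j) (fT j * fT i)
  | hecke (j : Fin r) :
      DahaRel r m ((fT j - algebraMap _ _ kVar) * (fT j + algebraMap _ _ kVar⁻¹)) 0
  | om_omInv : DahaRel r m (fOm * fOmInv) 1
  | omInv_om : DahaRel r m (fOmInv * fOm) 1
  | om_T (j : Fin r) : DahaRel r m (fOm * fT j) (fT (j + 1) * fOm)
  | X_zero : DahaRel r m (fX (0, 0)) 1
  | X_add (ν ν' : Fin r → ℤ) : DahaRel r m (fX (ν + ν', 0)) (fX (ν, 0) * fX (ν', 0))
  | cross (j : Fin r) (ν : Fin r → ℤ) :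
      DahaRel r m (fT j * fX (ν, 0) - fX ((ν, 0) - pair j ν • bRoot m j) * fT j)
        ((kVar - kVar⁻¹) • geomSum (fun i : ℤ => fX ((ν, 0) + i • bRoot m j)) (pair j ν))
  | om_X (ν : Fin r → ℤ) :
      DahaRel r m (fOm * fX (ν, 0)) (fX (fun i => ν (i - 1), -(m ^ 2 * ν (-1))) * fOm)

/-- The `GL_r` double affine Hecke algebra `ℍ⁽ᵐ⁾`. -/
abbrev Daha (r : ℕ) [NeZero r] (m : ℕ) : Type := RingQuot (DahaRel r m)

variable {m : ℕ}

/-- The canonical map from the free algebra. -/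
noncomputable abbrev toDaha (r : ℕ) [NeZero r] (m : ℕ) :
    FreeAlgebra BaseField (Gen r) →ₐ[BaseField] Daha r m :=
  RingQuot.mkAlgHom BaseField (DahaRel r m)

end Daha

/-! Helper facts: the operators satisfy the defining relations of the double affine Hecke algebra.
They are only used to define the representation `piHat` below. -/

theorem map_geomSum {M N : Type*} [AddCommGroup M] [AddCommGroup N] (S : M →+ N) (Z : ℤ → M)
    (u : ℤ) : S (geomSum Z u) = geomSum (fun i => S (Z i)) u := by
  unfold geomSum; split_ifs <;> simp

section
variable {L : Type*} [Field L]

/-- The scalar identity behind the braid relation. -/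
def BraidId (z w k zu wu zv wv A A' B B' ps ps' pt pt' pst Zst Wst Zs' Wt' : L) : Prop :=
  (1 - w) * ps * ((1 - z * w) * pst * ((1 - z) * pt * (A * A' * B * B') -
      (k - k⁻¹) * zv * (A * A' * B)) - (k - k⁻¹) * (Zst * Wst) * ((1 - z) * ps' - (k - k⁻¹) * Zs' * A))
    - (k - k⁻¹) * wu * ((1 - z * w) * pt * ((1 - z) * pst * (A * B * B') - (k - k⁻¹) * Zst * B)
      - (k - k⁻¹) * (zv * wv) * ((1 - z) * ps * A - (k - k⁻¹) * zu)) =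
  (1 - z) * pt * ((1 - z * w) * pst * ((1 - w) * ps * (A * A' * B * B') -
      (k - k⁻¹) * wu * (A * B * B')) - (k - k⁻¹) * (Zst * Wst) * ((1 - w) * pt' - (k - k⁻¹) * Wt' * B))
    - (k - k⁻¹) * zv * ((1 - z * w) * ps * ((1 - w) * pst * (A * A' * B) - (k - k⁻¹) * Wst * A)
      - (k - k⁻¹) * (zu * wu) * ((1 - w) * pt * B - (k - k⁻¹) * wv))

variable {z w k zu wu zv wv A A' B B' ps pt pst : L}

theorem braidId1 (hk : k ≠ 0) (h1 : zu ≠ 0) (h2 : wv ≠ 0) :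
    BraidId z w k zu wu zv wv zu wu wv zv k k k k k (zu * zv) (wu * wv) zu⁻¹ wv⁻¹ := by
  unfold BraidId; field_simp
theorem braidId2 (hk : k ≠ 0) (h1 : zu ≠ 0) (h2 : wv ≠ 0) (h3 : pt ≠ 0) :
    BraidId z w k zu wu zv wv zu wu B B' k k pt pt⁻¹ pt (zu * zv) (wu * wv) zu⁻¹ (w * wv⁻¹) := by
  unfold BraidId; field_simp; ring
theorem braidId3 (hk : k ≠ 0) (h1 : zu ≠ 0) (h2 : wv ≠ 0) (h3 : ps ≠ 0) :
    BraidId z w k zu wu zv wv A A' wv zv ps ps⁻¹ k k ps (zu * zv) (wu * wv) (z * zu⁻¹) wv⁻¹ := by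
  unfold BraidId; field_simp; ring
theorem braidId4 (hk : k ≠ 0) (h1 : zu ≠ 0) (h2 : wv ≠ 0) (h3 : ps ≠ 0) (h4 : pt ≠ 0) :
    BraidId z w k zu wu zv wv A A' B B' ps ps⁻¹ pt pt⁻¹ pst (zu * zv) (wu * wv) (z * zu⁻¹)
      (w * wv⁻¹) := by
  unfold BraidId; field_simp; ring
theorem braidId5 (hk : k ≠ 0) (h1 : zu ≠ 0) (h2 : wv ≠ 0) (h3 : ps ≠ 0) (h4 : pt ≠ 0)
    (hz : z ≠ 0) (hw : w ≠ 0) :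
    BraidId z w k zu wu zv wv A A' B B' ps ps⁻¹ pt pt⁻¹ pst (zu * zv * z⁻¹) (wu * wv * w⁻¹)
      (z * zu⁻¹) (w * wv⁻¹) := by
  unfold BraidId; field_simp; ring
theorem braidId6 (hk : k ≠ 0) (h1 : zu ≠ 0) (h2 : wv ≠ 0) (h3 : ps ≠ 0) (hA : A ≠ 0)
    (hA' : A' ≠ 0) (hz : z ≠ 0) (hw : w ≠ 0) :
    BraidId z w k zu wu zv wv A A' (wu * wv * w⁻¹ * A'⁻¹) (zu * zv * z⁻¹ * A⁻¹)
      ps ps⁻¹ ps⁻¹ ps k (zu * zv * z⁻¹) (wu * wv * w⁻¹) (z * zu⁻¹) (w * wv⁻¹) := by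
  unfold BraidId; field_simp; ring

theorem braid_field {h x ax bx abx bax aba X BX AX ABX X2 AX2 X3 V AV BV BAV V2 BV2 V3 : L}
    (hz : z ≠ 0) (hw : w ≠ 0) (hz1 : 1 - z ≠ 0) (hw1 : 1 - w ≠ 0) (hzw : 1 - z * w ≠ 0)
    (e1 : (1 - z) * X = ax + h * x) (e2 : (1 - z * w) * BX = bax + h * bx)
    (e3 : (1 - z⁻¹) * AX = ((1 - z) * (1 - z⁻¹) + h ^ 2) * x + h * ax)
    (e4 : (1 - w) * ABX = aba + h * abx) (e5 : (1 - w) * X2 = BX + h * X)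
    (e6 : (1 - z * w) * AX2 = ABX + h * AX) (e7 : (1 - z) * X3 = AX2 + h * X2)
    (f1 : (1 - w) * V = bx + h * x) (f2 : (1 - z * w) * AV = abx + h * ax)
    (f3 : (1 - w⁻¹) * BV = ((1 - w) * (1 - w⁻¹) + h ^ 2) * x + h * bx)
    (f4 : (1 - z) * BAV = aba + h * bax) (f5 : (1 - z) * V2 = AV + h * V)
    (f6 : (1 - z * w) * BV2 = BAV + h * BV) (f7 : (1 - w) * V3 = BV2 + h * V2) : X3 = V3 := by
  have hz2 : z - 1 ≠ 0 := fun h => hz1 (by linear_combination -h)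
  have hw2 : w - 1 ≠ 0 := fun h => hw1 (by linear_combination -h)
  have e3' : AX = z * (((1 - z) * (1 - z⁻¹) + h ^ 2) * x + h * ax) / (z - 1) := by
    rw [← e3]; field_simp
  have f3' : BV = w * (((1 - w) * (1 - w⁻¹) + h ^ 2) * x + h * bx) / (w - 1) := by
    rw [← f3]; field_simp
  rw [mul_comm, ← eq_div_iff ‹_›] at e1 e2 e4 e5 e6 e7 f1 f2 f4 f5 f6 f7
  rw [e7, f7, e6, f6, e5, f5, e4, f4, e3', f3', e2, f2, e1, f1]
  have q : z - 1 = -(1 - z) := by ring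
  have q' : w - 1 = -(1 - w) := by ring
  have hzw' : 1 - w * z ≠ 0 := by rwa [mul_comm]
  rw [q, q']
  field_simp
  ring
end

/-- The properties of the multiplicity functions that are used (satisfied by `multP`, see below). -/
structure IsMult {K : Type*} [Field K] (k : K) (m : ℕ) (p : ℤ → K) : Prop where
  add_mul : ∀ s t : ℤ, p (s + m * t) = p s
  dvd : ∀ s : ℤ, (m : ℤ) ∣ s → p s = k
  inv : ∀ s : ℤ, ¬ (m : ℤ) ∣ s → p s * p (-s) = 1

/-- `T` acts on the exponentials `e x` by the metaplectic Demazure-Lusztig formula in direction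
`β` (satisfied by `opT`, see below). -/
structure DL {K A Λ : Type*} [Field K] [CommRing A] [Algebra K A] [AddCommGroup Λ]
    (e : Λ → A) (k : K) (m : ℕ) (p : ℤ → K) (β : Λ) (l : Λ →+ ℤ) (T : A →ₗ[K] A) : Prop where
  hT : ∀ x, T (e x) = (k - k⁻¹) • geomSum (fun i => e (x + (i * m) • β)) (l x / m)
    + p (l x) • e (x - l x • β)
  hl : l β = 2
  hz : e ((m : ℤ) • β) ≠ 1

/-- `e` is an exponential map with spanning image (satisfied by `mono`, see below). -/
structure IsExp {K A Λ : Type*} [Field K] [CommRing A] [Algebra K A] [AddCommGroup Λ]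
    (e : Λ → A) : Prop where
  zero : e 0 = 1
  add : ∀ x y, e (x + y) = e x * e y
  ext : ∀ f g : A →ₗ[K] A, (∀ x, f (e x) = g (e x)) → f = g

section
variable {K A Λ : Type*} [Field K] [CommRing A] [IsDomain A] [Algebra K A] [AddCommGroup Λ]
    {e : Λ → A} {k : K} {m : ℕ} {p : ℤ → K}

/-- The intertwiner `(1 - z) T - (k - k⁻¹)`. -/
def intw (k : K) (z : A) (T : A →ₗ[K] A) : A →ₗ[K] A :=
  LinearMap.mulLeft K (1 - z) ∘ₗ T - (k - k⁻¹) • LinearMap.id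

theorem intw_apply (k : K) (z : A) (T : A →ₗ[K] A) (x : A) :
    intw k z T x = (1 - z) * T x - (k - k⁻¹) • x := rfl

theorem intw_mono (he : IsExp (K := K) e) {β : Λ} {l : Λ →+ ℤ} {T : A →ₗ[K] A}
    (h : DL e k m p β l T) (x : Λ) :
    intw k (e ((m : ℤ) • β)) T (e x) = (1 - e ((m : ℤ) • β)) * (p (l x) • e (x - l x • β))
      - (k - k⁻¹) • e (x - (l x / m * m) • β) := by
  have := geomSum_spec (fun i : ℤ => e (x + (i * m) • β)) (AddMonoidHom.mulLeft (e ((m : ℤ) • β)))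
    (fun i => by
      simp only [AddMonoidHom.coe_mulLeft, ← he.add]; congr 1; module) (l x / m)
  simp only [AddMonoidHom.coe_mulLeft, zero_mul, zero_smul, add_zero] at this
  rw [intw_apply, h.hT, show x - (l x / m * m) • β = x + (-(l x / m) * m) • β by module]
  simp only [Algebra.smul_def] at this ⊢
  linear_combination algebraMap K A (k - k⁻¹) * this

theorem intw_mul (he : IsExp (K := K) e) (hp : IsMult k m p) (hm : 0 < m) {β : Λ} {l : Λ →+ ℤ}
    {T : A →ₗ[K] A} (h : DL e k m p β l T) (d : Λ) (x : A) :
    intw k (e ((m : ℤ) • β)) T (e ((m : ℤ) • d) * x) =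
      e ((m : ℤ) • (d - l d • β)) * intw k (e ((m : ℤ) • β)) T x := by
  suffices intw k (e ((m : ℤ) • β)) T ∘ₗ LinearMap.mulLeft K (e ((m : ℤ) • d)) =
      LinearMap.mulLeft K (e ((m : ℤ) • (d - l d • β))) ∘ₗ intw k (e ((m : ℤ) • β)) T from
    LinearMap.congr_fun this x
  refine he.ext _ _ fun y => ?_
  have hm' : (m : ℤ) ≠ 0 := by lia
  simp only [LinearMap.comp_apply, LinearMap.mulLeft_apply, ← he.add, intw_mono he h, map_add,
    map_zsmul, smul_eq_mul]
  rw [add_comm ((m : ℤ) * l d), hp.add_mul, Int.add_mul_ediv_left _ _ hm']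
  rw [show (m : ℤ) • d + y - (l y + ↑m * l d) • β = (m : ℤ) • (d - l d • β) + (y - l y • β) by
      module,
    show (m : ℤ) • d + y - ((l y / ↑m + l d) * ↑m) • β =
      (m : ℤ) • (d - l d • β) + (y - (l y / m * m) • β) by module, he.add, he.add]
  simp only [Algebra.smul_def]
  ring

theorem isUnit_exp (he : IsExp (K := K) e) (x : Λ) : e x * e (-x) = 1 := by
  rw [← he.add, add_neg_cancel, he.zero]

theorem neg_ediv_of_not {m s : ℤ} (hm : 0 < m) (hd : ¬ m ∣ s) : -s / m = -(s / m) - 1 := by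
  rw [Int.neg_ediv, if_neg hd, Int.sign_eq_one_of_pos hm]

theorem intw_sq (he : IsExp (K := K) e) (hk : k ≠ 0) (hp : IsMult k m p) (hm : 0 < m) {β : Λ}
    {l : Λ →+ ℤ} {T : A →ₗ[K] A} (h : DL e k m p β l T) (x : A) :
    intw k (e ((m : ℤ) • β)) T (intw k (e ((m : ℤ) • β)) T x) =
      ((1 - e ((m : ℤ) • β)) * (1 - e (-((m : ℤ) • β))) + algebraMap K A ((k - k⁻¹) ^ 2)) * x := by
  suffices intw k (e ((m : ℤ) • β)) T ∘ₗ intw k (e ((m : ℤ) • β)) T =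
      LinearMap.mulLeft K ((1 - e ((m : ℤ) • β)) * (1 - e (-((m : ℤ) • β))) +
        algebraMap K A ((k - k⁻¹) ^ 2)) from
    LinearMap.congr_fun this x
  refine he.ext _ _ fun y => ?_
  have hm' : (m : ℤ) ≠ 0 := by lia
  have e1 : ∀ x, intw k (e ((m : ℤ) • β)) T (e ((m : ℤ) • β) * x) =
      e (-((m : ℤ) • β)) * intw k (e ((m : ℤ) • β)) T x := fun x => by
    rw [intw_mul he hp hm h, h.hl]; congr 2; module
  have e2 : ∀ (u : ℤ) x, intw k (e ((m : ℤ) • β)) T (e (-(u * m) • β) * x) =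
      e ((u * m) • β) * intw k (e ((m : ℤ) • β)) T x := fun u x => by
    rw [show (-(u * m)) • β = (m : ℤ) • (-u • β) by module, intw_mul he hp hm h, map_zsmul, h.hl]
    congr 2; simp only [smul_eq_mul]; module
  have hl' : l (y - l y • β) = - l y := by
    rw [map_sub, map_zsmul, h.hl, smul_eq_mul]; ring
  simp only [LinearMap.comp_apply, LinearMap.mulLeft_apply]
  rw [intw_mono he h y, show y - (l y / m * m) • β = -(l y / m * m) • β + y by module, he.add,
    map_sub, map_smul, sub_mul, one_mul, map_sub, e1, map_smul, e2, intw_mono he h,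
    intw_mono he h, hl', show y - (l y / m * m) • β = -(l y / m * m) • β + y by module, he.add,
    show y - l y • β - -l y • β = y by module,
    show y - l y • β - (-l y / m * m) • β = (-l y - -l y / m * m) • β + y by module, he.add,
    show y - l y • β = (-l y) • β + y by module, he.add]
  have hzz := isUnit_exp he ((m : ℤ) • β)
  have hkk : algebraMap K A k * algebraMap K A k⁻¹ = 1 := by
    rw [← map_mul, mul_inv_cancel₀ hk, map_one]
  have huu := isUnit_exp he ((l y / m * m) • β)
  rw [← neg_smul] at huu
  simp only [Algebra.smul_def, map_sub, map_pow]
  by_cases hd : (m : ℤ) ∣ l y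
  · obtain ⟨u, hu⟩ := hd
    have q1 : l y / m = u := by rw [hu, Int.mul_ediv_cancel_left _ hm']
    have q2 : -l y / m = -u := by rw [hu, ← mul_neg, Int.mul_ediv_cancel_left _ hm']
    rw [hp.dvd _ ⟨u, hu⟩, hp.dvd _ (dvd_neg.2 ⟨u, hu⟩), q2]
    rw [q1] at huu ⊢
    rw [show -l y = -(u * m) by rw [hu]; ring, show (-(u * m) - -u * m : ℤ) = 0 by ring, zero_smul,
      he.zero]
    linear_combination
      (-(algebraMap K A k - algebraMap K A k⁻¹) * ((1 - e ((m : ℤ) • β)) * algebraMap K A k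
        - (algebraMap K A k - algebraMap K A k⁻¹)) * e y) * huu
      + (1 - e (-((m : ℤ) • β))) * (1 - e ((m : ℤ) • β)) * e y * hkk
      + algebraMap K A k * (algebraMap K A k - algebraMap K A k⁻¹) * e y * hzz
  · have hpp : algebraMap K A (p (l y)) * algebraMap K A (p (-l y)) = 1 := by
      rw [← map_mul, hp.inv _ hd, map_one]
    rw [show (-l y - -l y / m * m) • β = (-l y) • β + (l y / m * m) • β + (m : ℤ) • β by
      rw [neg_ediv_of_not (by lia) hd]; module, he.add, he.add]
    linear_combination
      (1 - e (-((m : ℤ) • β))) * (1 - e ((m : ℤ) • β)) * e y * hpp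
      + (algebraMap K A k - algebraMap K A k⁻¹) ^ 2 * e y * huu
      + algebraMap K A (p (l y)) * (algebraMap K A k - algebraMap K A k⁻¹) * e ((-l y) • β) *
        e ((l y / m * m) • β) * e y * hzz

theorem one_sub_mul_T (k : K) (z : A) (T : A →ₗ[K] A) (x : A) :
    (1 - z) * T x = intw k z T x + algebraMap K A (k - k⁻¹) * x := by
  rw [intw_apply, Algebra.smul_def]; ring

theorem intw_exp (he : IsExp (K := K) e) (hp : IsMult k m p) (hm : 0 < m) {β : Λ} {l : Λ →+ ℤ}
    {T : A →ₗ[K] A} (h : DL e k m p β l T) (d : Λ) (x : A) :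
    intw k (e ((m : ℤ) • β)) T (e ((m : ℤ) • d) * x) =
      e ((m : ℤ) • d + (-(m * l d)) • β) * intw k (e ((m : ℤ) • β)) T x := by
  rw [intw_mul he hp hm h]; congr 2; module

theorem T_sq (he : IsExp (K := K) e) (hk : k ≠ 0) (hp : IsMult k m p) (hm : 0 < m) {β : Λ}
    {l : Λ →+ ℤ} {T : A →ₗ[K] A} (h : DL e k m p β l T) (x : A) :
    T (T x) = (k - k⁻¹) • T x + x := by
  have h1 := one_sub_mul_T k (e ((m : ℤ) • β)) T x
  have h2 := one_sub_mul_T k (e ((m : ℤ) • β)) T (T x)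
  have h3 := congrArg (intw k (e ((m : ℤ) • β)) T) h1
  have hzz := isUnit_exp he ((m : ℤ) • β)
  rw [sub_mul, one_mul, map_sub, intw_mul he hp hm h, map_add, intw_sq he hk hp hm h,
    ← Algebra.smul_def, map_smul, h.hl, show β - (2 : ℤ) • β = -β by module, smul_neg] at h3
  simp only [Algebra.smul_def] at h3 ⊢
  have n1 : (1 - e ((m : ℤ) • β)) ≠ 0 := sub_ne_zero.2 h.hz.symm
  have n2 : (1 - e (-((m : ℤ) • β))) ≠ 0 := fun h0 => n1 (by
    linear_combination (-e ((m : ℤ) • β)) * h0 - hzz)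
  refine mul_left_cancel₀ n1 (mul_left_cancel₀ n2 ?_)
  simp only [map_pow] at h3
  linear_combination (1 - e (-((m : ℤ) • β))) * h2 + h3 - algebraMap K A (k - k⁻¹) * h1
    - algebraMap K A (k - k⁻¹) * T x * hzz

theorem T_cross (he : IsExp (K := K) e) (hp : IsMult k m p) (hm : 0 < m) {β : Λ}
    {l : Λ →+ ℤ} {T : A →ₗ[K] A} (h : DL e k m p β l T) (d : Λ) (x : A) :
    T (e ((m : ℤ) • d) * x) = e ((m : ℤ) • (d - l d • β)) * T x +
      (k - k⁻¹) • (geomSum (fun i => e ((m : ℤ) • (d + i • β))) (l d) * x) := by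
  have h1 := one_sub_mul_T k (e ((m : ℤ) • β)) T x
  have h2 := one_sub_mul_T k (e ((m : ℤ) • β)) T (e ((m : ℤ) • d) * x)
  have n1 : (1 - e ((m : ℤ) • β)) ≠ 0 := sub_ne_zero.2 h.hz.symm
  have h4 := geomSum_spec (fun i : ℤ => e ((m : ℤ) • (d + i • β)))
    (AddMonoidHom.mulLeft (e ((m : ℤ) • β)))
    (fun i => by
      simp only [AddMonoidHom.coe_mulLeft, ← he.add]; congr 1; module) (l d)
  rw [intw_mul he hp hm h] at h2
  simp only [AddMonoidHom.coe_mulLeft, zero_smul, add_zero, neg_smul, ← sub_eq_add_neg] at h4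
  refine mul_left_cancel₀ n1 ?_
  simp only [Algebra.smul_def]
  linear_combination h2 - e ((m : ℤ) • (d - l d • β)) * h1 - algebraMap K A (k - k⁻¹) * x * h4

theorem intw_half (he : IsExp (K := K) e) (hp : IsMult k m p) (hm : 0 < m) {a b : Λ}
    {la lb : Λ →+ ℤ} {Ta Tb : A →ₗ[K] A} (ha : DL e k m p a la Ta) (hb : DL e k m p b lb Tb)
    (hab : la b = -1) (hba : lb a = -1) (x : Λ) (s t : ℤ) (hs : la x = s) (ht : lb x = t)
    {P : ℤ → A} (hP : ∀ i, P i = algebraMap K A (p i)) {h : A} (hh : h = algebraMap K A (k - k⁻¹))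
    {z w zu wu zv wv A₁ A₂ B₁ B₂ Zst Wst Zs : A}
    (hz : e ((m : ℤ) • a) = z) (hw : e ((m : ℤ) • b) = w)
    (hzu : e (-(s / m * m) • a) = zu) (hwu : e (-(s / m * m) • b) = wu)
    (hzv : e (-(t / m * m) • a) = zv) (hwv : e (-(t / m * m) • b) = wv)
    (hA₁ : e (-s • a) = A₁) (hA₂ : e (-s • b) = A₂) (hB₁ : e (-t • b) = B₁) (hB₂ : e (-t • a) = B₂)
    (hZst : e (-((s + t) / m * m) • a) = Zst) (hWst : e (-((s + t) / m * m) • b) = Wst)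
    (hZs : e (-(-s / m * m) • a) = Zs) :
    intw k z Ta (intw k w Tb (intw k z Ta (e x))) =
    e x * ((1 - w) * P s * ((1 - z * w) * P (s + t) * ((1 - z) * P t * (A₁ * A₂ * B₁ * B₂) -
      h * zv * (A₁ * A₂ * B₁)) - h * (Zst * Wst) * ((1 - z) * P (-s) - h * Zs * A₁))
    - h * wu * ((1 - z * w) * P t * ((1 - z) * P (s + t) * (A₁ * B₁ * B₂) - h * Zst * B₁)
      - h * (zv * wv) * ((1 - z) * P s * A₁ - h * zu))) := by
  have c1 : ∀ X, intw k z Ta (w * X) = z * w * intw k z Ta X := fun X => by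
    rw [← hz, ← hw, intw_mul he hp hm ha, hab, ← he.add]; congr 2; module
  have c2 : ∀ X, intw k w Tb (z * X) = z * w * intw k w Tb X := fun X => by
    rw [← hz, ← hw, intw_mul he hp hm hb, hba, ← he.add]; congr 2; module
  have c3 : ∀ X, intw k z Ta (z * w * X) = w * intw k z Ta X := fun X => by
    rw [← hz, ← hw, ← he.add, ← smul_add, intw_mul he hp hm ha, map_add, hab, ha.hl]
    congr 2; module
  have d1 : ∀ (u : ℤ) X, intw k w Tb (e (-(u * m) • a) * X) =
      e (-(u * m) • a) * e (-(u * m) • b) * intw k w Tb X := fun u X => by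
    rw [show (-(u * m)) • a = (m : ℤ) • (-u • a) by module, ← hw, intw_mul he hp hm hb, map_zsmul,
      hba, ← he.add]
    congr 2; simp only [smul_eq_mul]; module
  have d2 : ∀ (u : ℤ) X, intw k z Ta (e (-(u * m) • b) * X) =
      e (-(u * m) • a) * e (-(u * m) • b) * intw k z Ta X := fun u X => by
    rw [show (-(u * m)) • b = (m : ℤ) • (-u • b) by module, ← hz, intw_mul he hp hm ha, map_zsmul,
      hab, ← he.add]
    congr 2; simp only [smul_eq_mul]; module
  have d3 : ∀ (u : ℤ) X, intw k z Ta (e (-(u * m) • a) * e (-(u * m) • b) * X) =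
      e (-(u * m) • b) * intw k z Ta X := fun u X => by
    rw [← he.add, ← smul_add, show (-(u * m)) • (a + b) = (m : ℤ) • (-u • (a + b)) by module, ← hz,
      intw_mul he hp hm ha, map_zsmul, map_add, hab, ha.hl]
    congr 2; simp only [smul_eq_mul]; module
  have m1 := intw_mono he ha x
  have m2 := intw_mono he hb x
  have m3 := intw_mono he hb (x - s • a)
  have m4 := intw_mono he ha (x - t • b)
  have m5 := intw_mono he ha (x - s • a)
  have m7 := intw_mono he ha (x - s • a - (s + t) • b)
  rw [hz] at m1 m4 m5 m7
  rw [hw] at m2 m3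
  rw [hs, show x - s • a = -s • a + x by module,
    show x - (s / m * m) • a = -(s / m * m) • a + x by module, he.add, he.add, hzu, hA₁] at m1
  rw [ht, show x - t • b = -t • b + x by module,
    show x - (t / m * m) • b = -(t / m * m) • b + x by module, he.add, he.add, hwv, hB₁] at m2
  have l3 : lb (x - s • a) = s + t := by
    rw [map_sub, map_zsmul, ht, hba, smul_eq_mul]; ring
  have l4 : la (x - t • b) = s + t := by
    rw [map_sub, map_zsmul, hs, hab, smul_eq_mul]; ring
  have l5 : la (x - s • a) = -s := by
    rw [map_sub, map_zsmul, hs, ha.hl, smul_eq_mul]; ring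
  have l7 : la (x - s • a - (s + t) • b) = t := by
    rw [map_sub, map_zsmul, l5, hab, smul_eq_mul]; ring
  have xa : e (x - s • a) = A₁ * e x := by rw [← hA₁, ← he.add]; congr 1; module
  have xb : e (x - t • b) = B₁ * e x := by rw [← hB₁, ← he.add]; congr 1; module
  have xba : e (x - s • a - (s + t) • b) = A₁ * A₂ * B₁ * e x := by
    rw [← hA₁, ← hA₂, ← hB₁, ← he.add, ← he.add, ← he.add]; congr 1; module
  rw [l3, xba, xa, show x - s • a - ((s + t) / m * m) • b = -((s + t) / m * m) • b + (x - s • a) by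
    module, he.add, hWst, xa] at m3
  rw [l4, xb, show x - t • b - (s + t) • a = -s • a + -t • b + -t • a + x by module, he.add, he.add,
    he.add, hA₁, hB₁, hB₂,
    show x - t • b - ((s + t) / m * m) • a = -((s + t) / m * m) • a + (x - t • b) by
    module, he.add, hZst, xb] at m4
  rw [l5, xa, show x - s • a - -s • a = x by module,
    show x - s • a - (-s / m * m) • a = -(-s / m * m) • a + (x - s • a) by module, he.add, hZs,
    xa] at m5
  rw [l7, xba, show x - s • a - (s + t) • b - t • a = -s • a + -s • b + -t • b + -t • a + x by
    module, he.add, he.add, he.add, he.add, hA₁, hA₂, hB₁, hB₂,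
    show x - s • a - (s + t) • b - (t / m * m) • a
      = -(t / m * m) • a + (x - s • a - (s + t) • b) by module, he.add, hzv, xba] at m7
  have d1' := d1 (s / m)
  have d2' := d2 (t / m)
  have d2'' := d2 ((s + t) / m)
  have d3' := d3 (s / m)
  rw [hzu, hwu] at d1' d3'
  rw [hzv, hwv] at d2'
  rw [hZst, hWst] at d2''
  rw [m1]
  simp only [sub_mul, one_mul, map_sub, map_smul, c2, d1', m2, m3]
  simp only [mul_sub, mul_smul_comm, map_sub, map_smul]
  simp only [c3, d3', d2', d2'', c1, m4, m5, m7, m1]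
  simp only [Algebra.smul_def, hP, hh]
  ring

theorem intw_braid (he : IsExp (K := K) e) (hk : k ≠ 0) (hp : IsMult k m p) (hm : 0 < m) {a b : Λ}
    {la lb : Λ →+ ℤ} {Ta Tb : A →ₗ[K] A} (ha : DL e k m p a la Ta) (hb : DL e k m p b lb Tb)
    (hab : la b = -1) (hba : lb a = -1) (x : A) :
    intw k (e ((m : ℤ) • a)) Ta (intw k (e ((m : ℤ) • b)) Tb (intw k (e ((m : ℤ) • a)) Ta x)) =
    intw k (e ((m : ℤ) • b)) Tb (intw k (e ((m : ℤ) • a)) Ta (intw k (e ((m : ℤ) • b)) Tb x)) := by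
  suffices intw k (e ((m : ℤ) • a)) Ta ∘ₗ intw k (e ((m : ℤ) • b)) Tb ∘ₗ
      intw k (e ((m : ℤ) • a)) Ta =
    intw k (e ((m : ℤ) • b)) Tb ∘ₗ intw k (e ((m : ℤ) • a)) Ta ∘ₗ intw k (e ((m : ℤ) • b)) Tb from
    LinearMap.congr_fun this x
  refine he.ext _ _ fun x => ?_
  simp only [LinearMap.comp_apply]
  obtain ⟨s, hs⟩ : ∃ s, la x = s := ⟨_, rfl⟩
  obtain ⟨t, ht⟩ : ∃ t, lb x = t := ⟨_, rfl⟩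
  rw [intw_half he hp hm ha hb hab hba x s t hs ht (P := fun i => algebraMap K A (p i))
      (fun _ => rfl) rfl rfl rfl rfl rfl rfl rfl rfl rfl rfl rfl rfl rfl rfl,
    intw_half he hp hm hb ha hba hab x t s ht hs (P := fun i => algebraMap K A (p i))
      (fun _ => rfl) rfl rfl rfl rfl rfl rfl rfl rfl rfl rfl rfl rfl rfl rfl, add_comm t s]
  congr 1
  have hE : ∀ x, algebraMap A (FractionRing A) (e x) ≠ 0 := fun x h0 => by
    have := congrArg (algebraMap A (FractionRing A)) (isUnit_exp he x)
    rw [map_mul, h0, zero_mul, map_one] at this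
    exact zero_ne_one this
  have hneg : ∀ x, algebraMap A (FractionRing A) (e (-x)) =
      (algebraMap A (FractionRing A) (e x))⁻¹ := fun x => by
    exact eq_inv_of_mul_eq_one_right (by rw [← map_mul, isUnit_exp he, map_one])
  set φ := algebraMap A (FractionRing A) with hφ
  set ψ : K → FractionRing A := fun c => φ (algebraMap K A c) with hψ
  have hψi : ∀ c, ψ c⁻¹ = (ψ c)⁻¹ := fun c => map_inv₀ ((algebraMap A (FractionRing A)).comp
    (algebraMap K A)) c
  have hψ0 : ∀ c, c ≠ 0 → ψ c ≠ 0 := fun c hc =>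
    (map_ne_zero ((algebraMap A (FractionRing A)).comp (algebraMap K A))).2 hc
  have hinv : ∀ s, ¬ (m : ℤ) ∣ s → p (-s) = (p s)⁻¹ := fun s hd =>
    eq_inv_of_mul_eq_one_right (hp.inv s hd)
  have hp0 : ∀ s, ¬ (m : ℤ) ∣ s → p s ≠ 0 := fun s hd h0 => by
    have := hp.inv s hd
    rw [h0, zero_mul] at this; exact zero_ne_one this
  have hm' : (0 : ℤ) < m := by lia
  -- the values of the exponentials in the fraction field
  have key : BraidId (φ (e ((m : ℤ) • a))) (φ (e ((m : ℤ) • b))) (ψ k)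
      (φ (e (-(s / m * m) • a))) (φ (e (-(s / m * m) • b)))
      (φ (e (-(t / m * m) • a))) (φ (e (-(t / m * m) • b)))
      (φ (e (-s • a))) (φ (e (-s • b))) (φ (e (-t • b))) (φ (e (-t • a)))
      (ψ (p s)) (ψ (p (-s))) (ψ (p t)) (ψ (p (-t))) (ψ (p (s + t)))
      (φ (e (-((s + t) / m * m) • a))) (φ (e (-((s + t) / m * m) • b)))
      (φ (e (-(-s / m * m) • a))) (φ (e (-(-t / m * m) • b))) := by
    have f1 : ∀ c : Λ, φ (e (-(-s / m * m) • c)) = if (m : ℤ) ∣ s then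
        (φ (e (-(s / m * m) • c)))⁻¹ else φ (e ((m : ℤ) • c)) * (φ (e (-(s / m * m) • c)))⁻¹ := by
      intro c
      rw [← hneg]
      split_ifs with hd
      · rw [Int.neg_ediv_of_dvd hd]; congr 2; module
      · rw [← map_mul, ← he.add, neg_ediv_of_not hm' hd]; congr 2; module
    have f2 : ∀ c : Λ, φ (e (-(-t / m * m) • c)) = if (m : ℤ) ∣ t then
        (φ (e (-(t / m * m) • c)))⁻¹ else φ (e ((m : ℤ) • c)) * (φ (e (-(t / m * m) • c)))⁻¹ := by
      intro c
      rw [← hneg]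
      split_ifs with hd
      · rw [Int.neg_ediv_of_dvd hd]; congr 2; module
      · rw [← map_mul, ← he.add, neg_ediv_of_not hm' hd]; congr 2; module
    have f3 : ∀ c : Λ, φ (e (-((s + t) / m * m) • c)) = if (m : ℤ) ≤ s % m + t % m then
        φ (e (-(s / m * m) • c)) * φ (e (-(t / m * m) • c)) * (φ (e ((m : ℤ) • c)))⁻¹ else
        φ (e (-(s / m * m) • c)) * φ (e (-(t / m * m) • c)) := by
      intro c
      rw [Int.add_ediv_of_pos hm']
      split_ifs with hd
      · rw [← hneg, ← map_mul, ← map_mul, ← he.add, ← he.add]; congr 2; module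
      · rw [← map_mul, ← he.add]; congr 2; module
    have f4 : ∀ {s : ℤ}, (m : ℤ) ∣ s → ∀ c : Λ, φ (e (-s • c)) = φ (e (-(s / m * m) • c)) := by
      intro s hd c
      rw [Int.ediv_mul_cancel hd]
    by_cases hs : (m : ℤ) ∣ s <;> by_cases ht : (m : ℤ) ∣ t
    · have h0 : ¬ (m : ℤ) ≤ s % m + t % m := by
        rw [Int.emod_eq_zero_of_dvd hs, Int.emod_eq_zero_of_dvd ht]; lia
      rw [f1, f2, f3, f3, if_neg h0, if_neg h0, if_pos hs, if_pos ht, f4 hs, f4 hs, f4 ht, f4 ht,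
        hp.dvd s hs, hp.dvd t ht, hp.dvd _ (dvd_neg.2 hs), hp.dvd _ (dvd_neg.2 ht),
        hp.dvd _ (dvd_add hs ht)]
      exact braidId1 (hψ0 _ hk) (hE _) (hE _)
    · have h0 : ¬ (m : ℤ) ≤ s % m + t % m := by
        have := Int.emod_lt_of_pos t hm'
        rw [Int.emod_eq_zero_of_dvd hs]; lia
      have hst : p (s + t) = p t := by
        obtain ⟨u, rfl⟩ := hs
        rw [add_comm, hp.add_mul]
      rw [f1, f2, f3, f3, if_neg h0, if_neg h0, if_pos hs, if_neg ht, f4 hs, f4 hs,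
        hp.dvd s hs, hp.dvd _ (dvd_neg.2 hs), hst, hinv t ht, hψi]
      exact braidId2 (hψ0 _ hk) (hE _) (hE _) (hψ0 _ (hp0 _ ht))
    · have h0 : ¬ (m : ℤ) ≤ s % m + t % m := by
        have := Int.emod_lt_of_pos s hm'
        rw [Int.emod_eq_zero_of_dvd ht]; lia
      have hst : p (s + t) = p s := by
        obtain ⟨u, rfl⟩ := ht
        rw [hp.add_mul]
      rw [f1, f2, f3, f3, if_neg h0, if_neg h0, if_neg hs, if_pos ht, f4 ht, f4 ht,
        hp.dvd t ht, hp.dvd _ (dvd_neg.2 ht), hst, hinv s hs, hψi]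
      exact braidId3 (hψ0 _ hk) (hE _) (hE _) (hψ0 _ (hp0 _ hs))
    · rw [f1, f2, f3, f3, if_neg hs, if_neg ht, hinv s hs, hinv t ht, hψi, hψi]
      by_cases h0 : (m : ℤ) ≤ s % m + t % m
      · rw [if_pos h0, if_pos h0]
        by_cases hst : (m : ℤ) ∣ s + t
        · have hu : s + t = (s / m * m) + (t / m * m) + m := by
            have := Int.add_ediv_of_pos (a := s) (b := t) hm'
            rw [if_pos h0] at this
            rw [← Int.ediv_mul_cancel hst, this]; ring
          have ht' : p t = (p s)⁻¹ := by
            rw [← hinv s hs]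
            obtain ⟨u, hu⟩ := hst
            rw [← hp.add_mul (-s) u, ← hu]; congr 1; ring
          have g1 : ∀ c : Λ, φ (e (-t • c)) = φ (e (-(s / m * m) • c)) * φ (e (-(t / m * m) • c)) *
              (φ (e ((m : ℤ) • c)))⁻¹ * (φ (e (-s • c)))⁻¹ := by
            intro c
            rw [← hneg, ← hneg, ← map_mul, ← map_mul, ← map_mul, ← he.add, ← he.add, ← he.add]
            generalize s / m = u at hu ⊢
            generalize t / m = v at hu ⊢
            obtain rfl : t = u * m + v * m + m - s := by lia
            congr 2; module
          rw [g1, g1, ht', hψi, inv_inv, hp.dvd _ hst]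
          exact braidId6 (hψ0 _ hk) (hE _) (hE _) (hψ0 _ (hp0 _ hs)) (hE _) (hE _) (hE _) (hE _)
        · exact braidId5 (hψ0 _ hk) (hE _) (hE _) (hψ0 _ (hp0 _ hs)) (hψ0 _ (hp0 _ ht)) (hE _)
            (hE _)
      · rw [if_neg h0, if_neg h0]
        exact braidId4 (hψ0 _ hk) (hE _) (hE _) (hψ0 _ (hp0 _ hs)) (hψ0 _ (hp0 _ ht))
  apply IsFractionRing.injective A (FractionRing A)
  have hkk : φ (algebraMap K A k⁻¹) = (φ (algebraMap K A k))⁻¹ := hψi k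
  simp only [← hφ, map_sub, map_mul, map_one, hkk]
  unfold BraidId at key
  simp only [hψ] at key ⊢
  linear_combination key

theorem T_braid (he : IsExp (K := K) e) (hk : k ≠ 0) (hp : IsMult k m p) (hm : 0 < m) {a b : Λ}
    {la lb : Λ →+ ℤ} {Ta Tb : A →ₗ[K] A} (ha : DL e k m p a la Ta) (hb : DL e k m p b lb Tb)
    (hab : la b = -1) (hba : lb a = -1) (hzw1 : e ((m : ℤ) • (a + b)) ≠ 1) (x : A) :
    Ta (Tb (Ta x)) = Tb (Ta (Tb x)) := by
  have hE : ∀ x, algebraMap A (FractionRing A) (e x) ≠ 0 := fun x h0 => by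
    have := congrArg (algebraMap A (FractionRing A)) (isUnit_exp he x)
    rw [map_mul, h0, zero_mul, map_one] at this
    exact zero_ne_one this
  have hneg : ∀ x, algebraMap A (FractionRing A) (e (-x)) =
      (algebraMap A (FractionRing A) (e x))⁻¹ := fun x => by
    exact eq_inv_of_mul_eq_one_right (by rw [← map_mul, isUnit_exp he, map_one])
  have hn1 : ∀ x, e x ≠ 1 → 1 - algebraMap A (FractionRing A) (e x) ≠ 0 := fun x hx => by
    rw [sub_ne_zero, ← map_one (algebraMap A (FractionRing A))]
    exact fun h => hx (IsFractionRing.injective A (FractionRing A) h).symm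
  have n1 := hn1 _ ha.hz
  have n2 := hn1 _ hb.hz
  have n3 := hn1 _ hzw1
  rw [smul_add, he.add, map_mul] at n3
  have hbr := intw_braid he hk hp hm ha hb hab hba x
  have hsqa := intw_sq he hk hp hm ha x
  have hsqb := intw_sq he hk hp hm hb x
  have ca : ∀ X, intw k (e ((m : ℤ) • a)) Ta (e ((m : ℤ) • a) * X) =
      e (-((m : ℤ) • a)) * intw k (e ((m : ℤ) • a)) Ta X := fun X => by
    rw [intw_mul he hp hm ha, ha.hl]; congr 2; module
  have cb : ∀ X, intw k (e ((m : ℤ) • b)) Tb (e ((m : ℤ) • b) * X) =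
      e (-((m : ℤ) • b)) * intw k (e ((m : ℤ) • b)) Tb X := fun X => by
    rw [intw_mul he hp hm hb, hb.hl]; congr 2; module
  have cab : ∀ X, intw k (e ((m : ℤ) • a)) Ta (e ((m : ℤ) • b) * X) =
      e ((m : ℤ) • a) * e ((m : ℤ) • b) * intw k (e ((m : ℤ) • a)) Ta X := fun X => by
    rw [intw_mul he hp hm ha, hab, ← he.add]; congr 2; module
  have cba : ∀ X, intw k (e ((m : ℤ) • b)) Tb (e ((m : ℤ) • a) * X) =
      e ((m : ℤ) • a) * e ((m : ℤ) • b) * intw k (e ((m : ℤ) • b)) Tb X := fun X => by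
    rw [intw_mul he hp hm hb, hba, ← he.add]; congr 2; module
  have caab : ∀ X, intw k (e ((m : ℤ) • a)) Ta (e ((m : ℤ) • a) * e ((m : ℤ) • b) * X) =
      e ((m : ℤ) • b) * intw k (e ((m : ℤ) • a)) Ta X := fun X => by
    rw [← he.add, ← smul_add, intw_mul he hp hm ha, map_add, ha.hl, hab]; congr 2; module
  have cbab : ∀ X, intw k (e ((m : ℤ) • b)) Tb (e ((m : ℤ) • a) * e ((m : ℤ) • b) * X) =
      e ((m : ℤ) • a) * intw k (e ((m : ℤ) • b)) Tb X := fun X => by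
    rw [← he.add, ← smul_add, intw_mul he hp hm hb, map_add, hb.hl, hba]; congr 2; module
  rw [map_pow] at hsqa hsqb
  have Ea := one_sub_mul_T k (e ((m : ℤ) • a)) Ta
  have Eb := one_sub_mul_T k (e ((m : ℤ) • b)) Tb
  have hna := hneg ((m : ℤ) • a)
  have hnb := hneg ((m : ℤ) • b)
  have ha0 := hE ((m : ℤ) • a)
  have hb0 := hE ((m : ℤ) • b)
  generalize e (-((m : ℤ) • a)) = zi at *
  generalize e (-((m : ℤ) • b)) = wi at *
  generalize e ((m : ℤ) • a) = z at *
  generalize e ((m : ℤ) • b) = w at *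
  set I := intw k z Ta
  set J := intw k w Tb
  set c := algebraMap K A (k - k⁻¹) with hc
  have Ic : ∀ X, I (c * X) = c * I X := fun X => by
    rw [hc, ← Algebra.smul_def, ← Algebra.smul_def, map_smul]
  have Jc : ∀ X, J (c * X) = c * J X := fun X => by
    rw [hc, ← Algebra.smul_def, ← Algebra.smul_def, map_smul]
  have e1 := Ea x
  have e2 := congrArg J e1
  have e3 := congrArg I e1
  have e4 := congrArg I e2
  have e5 := Eb (Ta x)
  have e6 := congrArg I e5
  have e7 := Ea (Tb (Ta x))
  have f1 := Eb x
  have f2 := congrArg I f1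
  have f3 := congrArg J f1
  have f4 := congrArg J f2
  have f5 := Ea (Tb x)
  have f6 := congrArg J f5
  have f7 := Eb (Ta (Tb x))
  simp only [sub_mul, one_mul, map_sub, map_add, ca, cb, cab, cba, caab, cbab, Ic, Jc, hsqa, hsqb,
    ← hbr] at e1 e2 e3 e4 e5 e6 e7 f1 f2 f3 f4 f5 f6 f7
  have inj := IsFractionRing.injective A (FractionRing A)
  apply inj
  set φ := algebraMap A (FractionRing A)
  apply braid_field (z := φ z) (w := φ w) (h := φ c) (x := φ x) (ax := φ (I x)) (bx := φ (J x))
    (abx := φ (I (J x))) (bax := φ (J (I x))) (aba := φ (I (J (I x))))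
    (X := φ (Ta x)) (BX := φ (J (Ta x))) (AX := φ (I (Ta x))) (ABX := φ (I (J (Ta x))))
    (X2 := φ (Tb (Ta x))) (AX2 := φ (I (Tb (Ta x))))
    (V := φ (Tb x)) (AV := φ (I (Tb x))) (BV := φ (J (Tb x))) (BAV := φ (J (I (Tb x))))
    (V2 := φ (Ta (Tb x))) (BV2 := φ (J (Ta (Tb x)))) ha0 hb0 n1 n2 n3
  · have := congrArg φ e1
    simp only [map_sub, map_add, map_mul, map_one] at this
    linear_combination this
  · have := congrArg φ e2
    simp only [map_sub, map_add, map_mul, map_one] at this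
    linear_combination this
  · have := congrArg φ e3
    rw [← hna]
    simp only [map_sub, map_add, map_mul, map_one, map_pow] at this
    linear_combination this
  · have := congrArg φ e4
    simp only [map_sub, map_add, map_mul, map_one] at this
    linear_combination this
  · have := congrArg φ e5
    simp only [map_sub, map_add, map_mul, map_one] at this
    linear_combination this
  · have := congrArg φ e6
    simp only [map_sub, map_add, map_mul, map_one] at this
    linear_combination this
  · have := congrArg φ e7
    simp only [map_sub, map_add, map_mul, map_one] at this
    linear_combination this
  · have := congrArg φ f1
    simp only [map_sub, map_add, map_mul, map_one] at this
    linear_combination this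
  · have := congrArg φ f2
    simp only [map_sub, map_add, map_mul, map_one] at this
    linear_combination this
  · have := congrArg φ f3
    rw [← hnb]
    simp only [map_sub, map_add, map_mul, map_one, map_pow] at this
    linear_combination this
  · have := congrArg φ f4
    simp only [map_sub, map_add, map_mul, map_one] at this
    linear_combination this
  · have := congrArg φ f5
    simp only [map_sub, map_add, map_mul, map_one] at this
    linear_combination this
  · have := congrArg φ f6
    simp only [map_sub, map_add, map_mul, map_one] at this
    linear_combination this
  · have := congrArg φ f7
    simp only [map_sub, map_add, map_mul, map_one] at this
    linear_combination this

theorem T_comm (he : IsExp (K := K) e) (hp : IsMult k m p) (hm : 0 < m) {a b : Λ}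
    {la lb : Λ →+ ℤ} {Ta Tb : A →ₗ[K] A} (ha : DL e k m p a la Ta) (hb : DL e k m p b lb Tb)
    (hab : la b = 0) (hba : lb a = 0) (x : A) : Ta (Tb x) = Tb (Ta x) := by
  have ca : ∀ X, intw k (e ((m : ℤ) • a)) Ta (e ((m : ℤ) • b) * X) =
      e ((m : ℤ) • b) * intw k (e ((m : ℤ) • a)) Ta X := fun X => by
    rw [intw_mul he hp hm ha, hab]; congr 2; module
  have cb : ∀ X, intw k (e ((m : ℤ) • b)) Tb (e ((m : ℤ) • a) * X) =
      e ((m : ℤ) • a) * intw k (e ((m : ℤ) • b)) Tb X := fun X => by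
    rw [intw_mul he hp hm hb, hba]; congr 2; module
  have da : ∀ (u : ℤ) X, intw k (e ((m : ℤ) • a)) Ta (e (-(u * m) • b) * X) =
      e (-(u * m) • b) * intw k (e ((m : ℤ) • a)) Ta X := fun u X => by
    rw [show (-(u * m)) • b = (m : ℤ) • (-u • b) by module, intw_mul he hp hm ha, map_zsmul, hab]
    congr 2; simp
  have db : ∀ (u : ℤ) X, intw k (e ((m : ℤ) • b)) Tb (e (-(u * m) • a) * X) =
      e (-(u * m) • a) * intw k (e ((m : ℤ) • b)) Tb X := fun u X => by
    rw [show (-(u * m)) • a = (m : ℤ) • (-u • a) by module, intw_mul he hp hm hb, map_zsmul, hba]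
    congr 2; simp
  have hI : intw k (e ((m : ℤ) • a)) Ta (intw k (e ((m : ℤ) • b)) Tb x) =
      intw k (e ((m : ℤ) • b)) Tb (intw k (e ((m : ℤ) • a)) Ta x) := by
    suffices intw k (e ((m : ℤ) • a)) Ta ∘ₗ intw k (e ((m : ℤ) • b)) Tb =
      intw k (e ((m : ℤ) • b)) Tb ∘ₗ intw k (e ((m : ℤ) • a)) Ta from LinearMap.congr_fun this x
    refine he.ext _ _ fun x => ?_
    simp only [LinearMap.comp_apply]
    have q1 : la (x - lb x • b) = la x := by rw [map_sub, map_zsmul, hab]; simp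
    have q2 : lb (x - la x • a) = lb x := by rw [map_sub, map_zsmul, hba]; simp
    have m1 := intw_mono he ha x
    have m2 := intw_mono he hb x
    have m3 := intw_mono he ha (x - lb x • b)
    have m4 := intw_mono he hb (x - la x • a)
    rw [q1, show x - lb x • b - (la x / m * m) • a = -(la x / m * m) • a + (x - lb x • b) by module,
      he.add] at m3
    rw [q2, show x - la x • a - (lb x / m * m) • b = -(lb x / m * m) • b + (x - la x • a) by module,
      he.add, show x - la x • a - lb x • b = x - lb x • b - la x • a by module] at m4
    rw [show x - (la x / m * m) • a = -(la x / m * m) • a + x by module, he.add] at m1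
    rw [show x - (lb x / m * m) • b = -(lb x / m * m) • b + x by module, he.add] at m2
    rw [m1, m2]
    simp only [sub_mul, one_mul, map_sub, map_smul, ca, cb, da, db, m1, m2, m3, m4]
    simp only [Algebra.smul_def]
    ring
  have n1 : (1 - e ((m : ℤ) • a)) ≠ 0 := sub_ne_zero.2 ha.hz.symm
  have n2 : (1 - e ((m : ℤ) • b)) ≠ 0 := sub_ne_zero.2 hb.hz.symm
  have Ea := one_sub_mul_T k (e ((m : ℤ) • a)) Ta
  have Eb := one_sub_mul_T k (e ((m : ℤ) • b)) Tb
  have e1 := congrArg (intw k (e ((m : ℤ) • a)) Ta) (Eb x)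
  have e2 := congrArg (intw k (e ((m : ℤ) • b)) Tb) (Ea x)
  simp only [← Algebra.smul_def] at e1 e2
  simp only [sub_mul, one_mul, map_sub, map_add, map_smul, ca, cb] at e1 e2
  simp only [Algebra.smul_def, map_sub] at e1 e2
  refine mul_left_cancel₀ n1 (mul_left_cancel₀ n2 ?_)
  have Ea' := Ea (Tb x)
  have Eb' := Eb (Ta x)
  have Eax := Ea x
  have Ebx := Eb x
  simp only [map_sub] at Ea' Eb' Eax Ebx
  linear_combination (1 - e ((m : ℤ) • b)) * Ea' - (1 - e ((m : ℤ) • a)) * Eb' + e1 - e2 + hI +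
    (algebraMap K A k - algebraMap K A k⁻¹) * (Ebx - Eax)
end

section Operators
variable {K : Type*} [Field K] {r : ℕ} {q k : K} {m : ℕ} {p : ℤ → K}

theorem isExp_mono (hq : q ≠ 0) : IsExp (K := K) (mono (r := r) q) where
  zero := by simp [mono, AddMonoidAlgebra.one_def]
  add x y := by
    rw [mono, mono, mono, AddMonoidAlgebra.single_mul_single, ← zpow_add₀ hq]; rfl
  ext f g h := by
    refine (AddMonoidAlgebra.basis (Fin r → ℤ) K).ext fun v => ?_
    have := h (v, 0)
    simpa [mono] using this

theorem linExt_mono (f : (Fin r → ℤ) → Laurent K r) (w : AffWeight r) :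
    linExt f (mono q w) = q ^ w.2 • f w.1 := by
  have h : mono q w = q ^ w.2 • AddMonoidAlgebra.basis (Fin r → ℤ) K w.1 := by
    simp [mono]
  rw [h, map_smul, linExt, Module.Basis.constr_basis]

theorem smul_mono (hq : q ≠ 0) (c : ℤ) (w : AffWeight r) :
    q ^ c • mono q w = mono q ((0, c) + w) := by
  rw [mono, mono, AddMonoidAlgebra.smul_single, smul_eq_mul, ← zpow_add₀ hq]; simp

theorem smul_geomSum {M : Type*} [AddCommGroup M] [Module K M] (c : K) (Z : ℤ → M) (u : ℤ) :
    c • geomSum Z u = geomSum (fun i => c • Z i) u :=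
  map_geomSum (DistribSMul.toAddMonoidHom M c) Z u

variable [NeZero r]

/-- The pairing, as an additive map on affine weights. -/
def pairHom (j : Fin r) : AffWeight r →+ ℤ where
  toFun w := pair j w.1
  map_zero' := by simp [pair]
  map_add' x y := by simp only [pair, Prod.fst_add, Pi.add_apply]; ring

theorem opT_mono (hq : q ≠ 0) (j : Fin r) (w : AffWeight r) :
    opT q k m p j (mono q w) =
      (k - k⁻¹) • geomSum (fun i : ℤ => mono q (w + (i * m) • simpleRoot m j)) (pair j w.1 / m)
        + p (pair j w.1) • mono q (reflect m j w) := by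
  have h : ∀ x : AffWeight r, ((0 : Fin r → ℤ), w.2) + ((w.1, 0) + x) = w + x := fun x => by
    rw [← add_assoc]; congr 1; ext <;> simp
  rw [opT, linExt_mono, smul_add, smul_comm, smul_geomSum, smul_comm (q ^ w.2)]
  simp only [smul_mono hq, h, reflect, sub_eq_add_neg]

theorem sub_one_ne (hr : 2 ≤ r) (j : Fin r) : j - 1 ≠ j := by
  intro h
  have h1 : (1 : Fin r) = 0 := by simpa using h
  have := congrArg Fin.val h1
  rw [Fin.val_one', Fin.val_zero, Nat.mod_eq_of_lt (by lia)] at this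
  exact one_ne_zero this

theorem pair_simpleRoot (i j : Fin r) : pair i (simpleRoot m j).1 =
    (if i - 1 = j - 1 then 1 else 0) - (if i - 1 = j then 1 else 0)
      - (if i = j - 1 then 1 else 0) + (if i = j then 1 else 0) := by
  simp only [pair, simpleRoot, Pi.sub_apply, Pi.single_apply]; ring

theorem mono_ne_one (hq : q ≠ 0) (hm : 0 < m) (j : Fin r) (w : AffWeight r)
    (h : pair j w.1 ≠ 0) : mono q ((m : ℤ) • w) ≠ 1 := by
  intro h1
  have hw : (m : ℤ) • w.1 ≠ 0 := smul_ne_zero (by lia) fun h0 => h (by simp [h0, pair])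
  have h2 := congrArg (fun f => AddMonoidAlgebra.coeff f ((m : ℤ) • w.1)) h1
  simp only [mono, AddMonoidAlgebra.one_def, AddMonoidAlgebra.coeff_single, Finsupp.single_apply,
    Prod.smul_fst, if_pos, if_neg hw.symm] at h2
  exact zpow_ne_zero _ hq h2

theorem dl_opT (hq : q ≠ 0) (hr : 2 ≤ r) (hm : 0 < m) (j : Fin r) :
    DL (mono (r := r) q) k m p (simpleRoot m j) (pairHom j) (opT q k m p j) where
  hT x := opT_mono hq j x
  hl := by
    have h := sub_one_ne hr j
    change pair j (simpleRoot m j).1 = 2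
    rw [pair_simpleRoot]; simp [h, h.symm]
  hz := mono_ne_one hq hm j _ (by
    have h := sub_one_ne hr j
    rw [pair_simpleRoot]; simp [h, h.symm])

theorem opOmega_mono (hq : q ≠ 0) (w : AffWeight r) :
    opOmega q m (mono q w) = mono q (omegaAct m w) := by
  rw [opOmega, linExt_mono, smul_mono hq]
  congr 1
  ext <;> simp [omegaAct]; ring

theorem opOmegaInv_mono (hq : q ≠ 0) (w : AffWeight r) :
    opOmegaInv q m (mono q w) = mono q (omegaInvAct m w) := by
  rw [opOmegaInv, linExt_mono, smul_mono hq]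
  congr 1
  ext <;> simp [omegaInvAct]

theorem omegaAct_inv (w : AffWeight r) : omegaAct m (omegaInvAct m w) = w := by
  ext <;> simp [omegaAct, omegaInvAct]

theorem omegaInv_act (w : AffWeight r) : omegaInvAct m (omegaAct m w) = w := by
  ext <;> simp [omegaAct, omegaInvAct]

theorem omegaAct_add_smul (w x : AffWeight r) (i : ℤ) :
    omegaAct m (w + i • x) = omegaAct m w + i • omegaAct m x := by
  ext <;> simp [omegaAct]; ring

theorem omegaAct_simpleRoot (j : Fin r) :
    omegaAct m (simpleRoot m j) = simpleRoot m (j + 1) := by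
  have h1 : ∀ i : Fin r, (i - 1 = j - 1) ↔ i = j := fun i => by simp
  have h2 : ∀ i : Fin r, (i - 1 = j) ↔ i = j + 1 := fun i => sub_eq_iff_eq_add
  have h3 : ((-1 : Fin r) = j - 1) ↔ j = 0 := by
    constructor
    · intro h
      have := congrArg (· + 1) h
      simpa using this.symm
    · rintro rfl; simp
  have h4 : ((-1 : Fin r) = j) ↔ j + 1 = 0 := by
    rw [add_eq_zero_iff_eq_neg, eq_comm]
  ext i
  · simp [omegaAct, simpleRoot, Pi.single_apply, h1, h2]
  · simp only [omegaAct, simpleRoot, Pi.sub_apply, Pi.single_apply, h3, h4]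
    split_ifs <;> simp

theorem pair_omegaAct (j : Fin r) (w : AffWeight r) : pair (j + 1) (omegaAct m w).1 = pair j w.1 := by
  simp [pair, omegaAct]

theorem opOmega_opT (hq : q ≠ 0) (j : Fin r) :
    opOmega q m ∘ₗ opT q k m p j = opT q k m p (j + 1) ∘ₗ opOmega q m := by
  refine (isExp_mono hq).ext _ _ fun w => ?_
  simp only [LinearMap.comp_apply, opT_mono hq, opOmega_mono hq, map_add, map_smul]
  have h := map_geomSum (opOmega (r := r) q m).toAddMonoidHom
    (fun i : ℤ => mono q (w + (i * m) • simpleRoot m j)) (pair j w.1 / m)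
  simp only [LinearMap.toAddMonoidHom_coe, opOmega_mono hq] at h
  rw [h]
  simp only [reflect, sub_eq_add_neg, ← neg_smul, omegaAct_add_smul, omegaAct_simpleRoot,
    pair_omegaAct]

theorem opOmega_opOmegaInv (hq : q ≠ 0) :
    opOmega (r := r) q m * opOmegaInv q m = (1 : Module.End K (Laurent K r)) :=
  (isExp_mono hq).ext _ _ fun w => by
    rw [Module.End.mul_apply, opOmegaInv_mono hq, opOmega_mono hq, omegaAct_inv,
      Module.End.one_apply]

theorem opOmegaInv_opOmega (hq : q ≠ 0) :
    opOmegaInv (r := r) q m * opOmega q m = (1 : Module.End K (Laurent K r)) :=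
  (isExp_mono hq).ext _ _ fun w => by
    rw [Module.End.mul_apply, opOmega_mono hq, opOmegaInv_mono hq, omegaInv_act,
      Module.End.one_apply]

theorem opOmega_mul (hq : q ≠ 0) (w : AffWeight r) (x : Laurent K r) :
    opOmega q m (mono q w * x) = mono q (omegaAct m w) * opOmega q m x := by
  suffices opOmega q m ∘ₗ LinearMap.mulLeft K (mono q w) =
      LinearMap.mulLeft K (mono q (omegaAct m w)) ∘ₗ opOmega q m from LinearMap.congr_fun this x
  refine (isExp_mono hq).ext _ _ fun y => ?_
  simp only [LinearMap.comp_apply, LinearMap.mulLeft_apply, ← (isExp_mono (K := K) hq).add,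
    opOmega_mono hq]
  have := omegaAct_add_smul (m := m) w y 1
  rw [one_smul, one_smul] at this
  rw [this]

theorem opX_apply (ν : Fin r → ℤ) (x : Laurent K r) :
    opX m ν x = mono q ((m : ℤ) • (ν, 0)) * x := by
  simp [opX, mono]

theorem two_ne (hr : 3 ≤ r) (j : Fin r) : j + 1 ≠ j - 1 := by
  intro h
  have h1 : (1 : Fin r) + 1 = 0 := by
    have := congrArg (fun i => i - j + 1) h
    simpa using this
  have := congrArg Fin.val h1
  rw [Fin.val_add, Fin.val_one', Fin.val_zero, Nat.mod_eq_of_lt (a := 1) (by lia),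
    Nat.mod_eq_of_lt (by lia)] at this
  lia

theorem pair_next (hr : 3 ≤ r) (j : Fin r) : pair j (simpleRoot m (j + 1)).1 = -1 := by
  have h1 := sub_one_ne (by lia : 2 ≤ r) j
  have h2 := two_ne hr j
  have h3 := sub_one_ne (by lia : 2 ≤ r) (j + 1)
  rw [add_sub_cancel_right] at h3
  rw [pair_simpleRoot]; simp [h1, h2.symm, h3]

theorem pair_prev (hr : 3 ≤ r) (j : Fin r) : pair (j + 1) (simpleRoot m j).1 = -1 := by
  have h1 := sub_one_ne (by lia : 2 ≤ r) j
  have h2 := two_ne hr j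
  have h3 := sub_one_ne (by lia : 2 ≤ r) (j + 1)
  rw [add_sub_cancel_right] at h3
  rw [pair_simpleRoot]; simp [h1.symm, h2, h3.symm]

theorem pair_far {i j : Fin r} (h₁ : i ≠ j) (h₂ : i ≠ j + 1) (h₃ : j ≠ i + 1) :
    pair i (simpleRoot m j).1 = 0 := by
  have h4 : i - 1 ≠ j := fun h => h₂ (sub_eq_iff_eq_add.1 h)
  have h5 : i ≠ j - 1 := fun h => h₃ (eq_sub_iff_add_eq.1 h).symm
  rw [pair_simpleRoot]; simp [h₁, h4, h5]

end Operators

section Representation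
variable {K : Type*} [Field K] [Algebra BaseField K] {r : ℕ} [NeZero r] {m : ℕ} {p : ℤ → K}

theorem qVar_ne : qVar ≠ 0 := by
  have := IsFractionRing.injective (MvPolynomial (Fin 2) ℂ) BaseField
  exact (map_ne_zero_iff _ this).2 (MvPolynomial.X_ne_zero _)

theorem kVar_ne : kVar ≠ 0 := by
  have := IsFractionRing.injective (MvPolynomial (Fin 2) ℂ) BaseField
  exact (map_ne_zero_iff _ this).2 (MvPolynomial.X_ne_zero _)

theorem qIn_ne : qIn K ≠ 0 := (map_ne_zero _).2 qVar_ne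

theorem kIn_ne : kIn K ≠ 0 := (map_ne_zero _).2 kVar_ne

/-- The operators by which the generators of the double affine Hecke algebra act. -/
noncomputable def genOp (m : ℕ) (p : ℤ → K) : Gen r → Module.End K (Laurent K r)
  | Gen.T j => opT (qIn K) (kIn K) m p j
  | Gen.om => opOmega (qIn K) m
  | Gen.omInv => opOmegaInv (qIn K) m
  | Gen.X ν => opX m ν

/-- The action of the free algebra. -/
noncomputable def freeAct (m : ℕ) (p : ℤ → K) :
    FreeAlgebra BaseField (Gen r) →ₐ[BaseField] Module.End K (Laurent K r) :=
  FreeAlgebra.lift BaseField (genOp m p)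

theorem freeAct_T (j : Fin r) : freeAct m p (fT j) = opT (qIn K) (kIn K) m p j := by
  simp [freeAct, genOp]

theorem freeAct_om : freeAct m p fOm = opOmega (r := r) (qIn K) m := by
  simp [freeAct, genOp]

theorem freeAct_omInv : freeAct m p fOmInv = opOmegaInv (r := r) (qIn K) m := by
  simp [freeAct, genOp]

theorem freeAct_X (ν : Fin r → ℤ) :
    freeAct m p (FreeAlgebra.ι _ (Gen.X ν)) = opX (K := K) m ν := by
  simp [freeAct, genOp]

theorem freeAct_fX (w : AffWeight r) (x : Laurent K r) :
    freeAct m p (fX w) x = mono (qIn K) ((m : ℤ) • w.1, w.2) * x := by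
  rw [fX, map_smul, freeAct_X, LinearMap.smul_apply, opX_apply (q := qIn K), ← smul_mul_assoc, ← algebraMap_smul K, map_zpow₀,
    show algebraMap BaseField K qVar = qIn K from rfl, smul_mono qIn_ne]
  congr 2
  ext <;> simp

theorem freeAct_rel (hr : 2 ≤ r) (hm : 0 < m) (hp : IsMult (kIn K) m p) ⦃x y⦄
    (h : DahaRel r m x y) : freeAct m p x = freeAct m p y := by
  have he := isExp_mono (r := r) (qIn_ne (K := K))
  have hd := dl_opT (k := kIn K) (p := p) (qIn_ne (K := K)) hr hm
  have hk := kIn_ne (K := K)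
  have hk1 : ∀ y : Laurent K r, kVar • y = kIn K • y := fun y => (algebraMap_smul K kVar y).symm
  have hk2 : ∀ y : Laurent K r, kVar⁻¹ • y = (kIn K)⁻¹ • y := fun y => by
    rw [← algebraMap_smul K, map_inv₀]; rfl
  have hk3 : ∀ y : Laurent K r, (kVar - kVar⁻¹) • y = (kIn K - (kIn K)⁻¹) • y := fun y => by
    rw [sub_smul, sub_smul, hk1, hk2]
  refine LinearMap.ext fun v => ?_
  cases h with
  | braid hr3 j =>
    simp only [map_mul, freeAct_T, Module.End.mul_apply]
    refine T_braid he hk hp hm (hd j) (hd (j + 1)) (pair_next hr3 j) (pair_prev hr3 j)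
      (mono_ne_one qIn_ne hm j _ ?_) v
    have : pairHom j (simpleRoot m j + simpleRoot m (j + 1)) = 1 := by
      rw [map_add, (hd j).hl]
      change 2 + pair j (simpleRoot m (j + 1)).1 = 1
      rw [pair_next hr3]; rfl
    exact this.trans_ne one_ne_zero
  | comm i j h₁ h₂ h₃ =>
    simp only [map_mul, freeAct_T, Module.End.mul_apply]
    exact T_comm he hp hm (hd i) (hd j) (pair_far h₁ h₂ h₃) (pair_far h₁.symm h₃ h₂) v
  | hecke j =>
    have h2 := T_sq he hk hp hm (hd j) v
    simp only [map_mul, map_sub, map_add, freeAct_T, AlgHom.commutes, Module.End.mul_apply,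
      LinearMap.sub_apply, LinearMap.add_apply, Module.algebraMap_end_apply, map_zero,
      LinearMap.zero_apply, hk1, hk2, map_smul, h2]
    have h9 : (kIn K)⁻¹ • kIn K • v = v := by rw [smul_smul, inv_mul_cancel₀ hk, one_smul]
    rw [smul_sub, h9, sub_smul]
    abel
  | om_omInv =>
    simp only [map_mul, freeAct_om, freeAct_omInv, map_one]
    rw [opOmega_opOmegaInv qIn_ne]
  | omInv_om =>
    simp only [map_mul, freeAct_om, freeAct_omInv, map_one]
    rw [opOmegaInv_opOmega qIn_ne]
  | om_T j =>
    simp only [map_mul, freeAct_T, freeAct_om, Module.End.mul_apply]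
    have := LinearMap.congr_fun (opOmega_opT (k := kIn K) (m := m) (p := p) (qIn_ne (K := K)) j) v
    simpa only [LinearMap.comp_apply] using this
  | X_zero =>
    rw [freeAct_fX, map_one, smul_zero, Module.End.one_apply]
    have := he.zero
    rw [Prod.zero_eq_mk] at this
    rw [this, one_mul]
  | X_add ν ν' =>
    rw [map_mul, Module.End.mul_apply, freeAct_fX, freeAct_fX, freeAct_fX, ← mul_assoc, ← he.add]
    rw [smul_add, Prod.mk_add_mk, add_zero]
  | cross j ν =>
    have h2 := T_cross he hp hm (hd j) (ν, 0) v
    have hl : pairHom j ((ν, 0) : AffWeight r) = pair j ν := rfl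
    rw [hl] at h2
    have h4 := map_geomSum ((LinearMap.applyₗ (R := K) v).toAddMonoidHom.comp
      (freeAct m p).toLinearMap.toAddMonoidHom)
      (fun i : ℤ => fX ((ν, 0) + i • bRoot m j)) (pair j ν)
    have h5 := map_geomSum (AddMonoidHom.mulRight v)
      (fun i : ℤ => mono (qIn K) ((m : ℤ) • ((ν, 0) + i • simpleRoot m j))) (pair j ν)
    have h6 : ∀ i : ℤ, ((m : ℤ) • ((ν, 0) + i • bRoot m j).1, ((ν, 0) + i • bRoot m j).2) =
      (m : ℤ) • ((ν, 0) + i • simpleRoot m j) := fun i => by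
      ext
      · simp [bRoot]; ring
      · simp [bRoot]; ring
    have h7 := h6 (-pair j ν)
    rw [neg_smul, neg_smul, ← sub_eq_add_neg, ← sub_eq_add_neg] at h7
    simp only [AddMonoidHom.coe_comp, Function.comp_apply, LinearMap.toAddMonoidHom_coe,
      LinearMap.applyₗ_apply_apply, AlgHom.toLinearMap_apply, freeAct_fX, h6] at h4
    simp only [AddMonoidHom.coe_mulRight] at h5
    rw [map_sub, map_mul, map_mul, map_smul, LinearMap.sub_apply, Module.End.mul_apply,
      Module.End.mul_apply, freeAct_fX, freeAct_fX, freeAct_T, LinearMap.smul_apply, h4, h7, ← h5,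
      hk3, sub_eq_iff_eq_add', ← h2]
    simp
  | om_X ν =>
    rw [map_mul, map_mul, Module.End.mul_apply, Module.End.mul_apply, freeAct_fX, freeAct_fX,
      freeAct_om, opOmega_mul qIn_ne]
    congr 2
    ext <;> simp [omegaAct]; ring

end Representation

section Parameters
variable {n : ℕ} {κ : ℤ} {ε : ℤˣ}

theorem gVar_ne {j : ℕ} (h : 1 ≤ j ∧ 2 * j < n) : gVar n j ≠ 0 := by
  have := IsFractionRing.injective (MvPolynomial {j : ℕ // 1 ≤ j ∧ 2 * j < n} BaseField)
    (BigField n)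
  rw [gVar, dif_pos h]
  exact (map_ne_zero_iff _ this).2 (MvPolynomial.X_ne_zero _)

theorem gParam_of_dvd {s : ℤ} (h : (n : ℤ) ∣ s) : gParam n ε s = -1 := by
  simp [gParam, Int.emod_eq_zero_of_dvd h]

theorem gParam_mul (hn : 0 < n) {s : ℤ} (h : ¬ (n : ℤ) ∣ s) :
    gParam n ε s * gParam n ε (-s) = ((algebraMap BaseField (BigField n) kVar) ^ 2)⁻¹ := by
  have hn' : (0 : ℤ) < n := by lia
  have h1 := Int.emod_nonneg s hn'.ne'
  have h2 := Int.emod_lt_of_pos s hn'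
  have h3 : s % n ≠ 0 := fun h0 => h (Int.dvd_of_emod_eq_zero h0)
  have h4 : (-s) % n = n - s % n := by
    rw [Int.neg_emod, if_neg h]; simp
  obtain ⟨j, hj⟩ := Int.eq_ofNat_of_zero_le h1
  have h5 : ((-s) % n).toNat = n - j := by rw [h4, hj]; lia
  have h6 : (s % n).toNat = j := by rw [hj]; simp
  simp only [gParam, h5, h6]
  have hk : algebraMap BaseField (BigField n) kVar ≠ 0 := (map_ne_zero _).2 kVar_ne
  rcases lt_trichotomy (2 * j) n with hlt | heq | hgt
  · have := gVar_ne (n := n) (j := j) ⟨by lia, hlt⟩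
    rw [if_neg (by lia), if_pos hlt, if_neg (by lia), if_neg (by lia), if_neg (by lia),
      show n - (n - j) = j by lia]
    field_simp
  · rw [if_neg (by lia), if_neg (by lia), if_pos heq, if_neg (by lia), if_neg (by lia),
      if_pos (by lia)]
    rcases Int.units_eq_one_or ε with rfl | rfl <;> simp <;> field_simp
  · have := gVar_ne (n := n) (j := n - j) ⟨by lia, by lia⟩
    rw [if_neg (by lia), if_neg (by lia), if_neg (by lia), if_neg (by lia), if_pos (by lia)]
    field_simp

theorem mNum_pos (hn : 0 < n) : 0 < mNum n κ :=
  Nat.div_pos (Nat.le_of_dvd hn (by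
    have := Int.gcd_dvd_left (n : ℤ) κ
    exact_mod_cast this)) (Int.gcd_pos_of_ne_zero_left _ (by lia))

theorem dvd_iff (hn : 0 < n) (s : ℤ) : (n : ℤ) ∣ κ * s ↔ (mNum n κ : ℤ) ∣ s := by
  have hg : 0 < Int.gcd n κ := Int.gcd_pos_of_ne_zero_left _ (by lia)
  have ha := Int.mul_ediv_cancel' (Int.gcd_dvd_left (n : ℤ) κ)
  have hb := Int.mul_ediv_cancel' (Int.gcd_dvd_right (n : ℤ) κ)
  have hco := Int.isCoprime_iff_gcd_eq_one.2 (Int.gcd_ediv_gcd_ediv_gcd hg)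
  have hm : (mNum n κ : ℤ) = n / (Int.gcd n κ : ℤ) := by
    rw [mNum, Int.natCast_div]
  rw [hm]
  have h1 : (n : ℤ) ∣ κ * s ↔ (n : ℤ) / (Int.gcd n κ : ℤ) ∣ κ / (Int.gcd n κ : ℤ) * s := by
    have h := mul_dvd_mul_iff_left (a := (Int.gcd n κ : ℤ)) (b := n / (Int.gcd n κ : ℤ))
      (c := κ / (Int.gcd n κ : ℤ) * s) (by lia)
    rwa [← mul_assoc, ha, hb] at h
  exact h1.trans ⟨fun h => hco.dvd_of_dvd_mul_left h, fun h => h.mul_left _⟩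

theorem isMult_multP (hn : 0 < n) : IsMult (kIn (ParamField n κ ε)) (mNum n κ) (multP n κ ε) where
  add_mul s t := by
    have : gSub n κ ε (-(s + mNum n κ * t)) = gSub n κ ε (-s) := by
      apply Subtype.ext
      change gParam n ε _ = gParam n ε _
      have h : (κ * -(s + mNum n κ * t)) % n = (κ * -s) % n := by
        obtain ⟨c, hc⟩ := (dvd_iff (κ := κ) hn (mNum n κ)).2 dvd_rfl
        rw [show κ * -(s + mNum n κ * t) = κ * -s + n * (-c * t) by linear_combination -t * hc,
          Int.add_mul_emod_self_left]
      simp only [gParam, h]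
    rw [multP, multP, this]
  dvd s h := by
    have : gSub n κ ε (-s) = -1 := by
      apply Subtype.ext
      exact gParam_of_dvd ((dvd_iff hn _).2 (dvd_neg.2 h))
    rw [multP, this]; ring
  inv s h := by
    have h1 : gSub n κ ε (-s) * gSub n κ ε s = ((kIn (ParamField n κ ε)) ^ 2)⁻¹ := by
      apply Subtype.ext
      have := gParam_mul (ε := ε) hn (s := κ * -s) (fun h0 => h (by
        rw [dvd_iff hn] at h0; exact dvd_neg.1 h0))
      rw [show -(κ * -s) = κ * s by ring] at this
      exact this
    rw [multP, multP, neg_neg, show -kIn (ParamField n κ ε) * gSub n κ ε (-s) *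
      (-kIn _ * gSub n κ ε s) = kIn _ ^ 2 * (gSub n κ ε (-s) * gSub n κ ε s) by ring, h1]
    exact mul_inv_cancel₀ (pow_ne_zero 2 kIn_ne)

end Parameters

/-! The representation, the elements `Y`, and the eigenvalues. -/

section Main
variable (r n : ℕ) [r.AtLeastTwo] [NeZero n] (κ : ℤ) (ε : ℤˣ)

/-- The metaplectic basic representation of `ℍ⁽ᵐ⁾` on `K^(n,κ)[x^{±1}]`. -/
noncomputable def piHat : Daha r (mNum n κ) →ₐ[BaseField]
    Module.End (ParamField n κ ε) (Laurent (ParamField n κ ε) r) :=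
  RingQuot.liftAlgHom BaseField ⟨freeAct (mNum n κ) (multP n κ ε), fun _ _ h =>
    freeAct_rel Nat.AtLeastTwo.prop (mNum_pos (NeZero.pos n)) (isMult_multP (NeZero.pos n)) h⟩

/-- The generator `T_j` acts by `opT`. -/
theorem piHat_T (j : Fin r) : piHat r n κ ε (toDaha r (mNum n κ) (fT j)) =
    opT (qIn _) (kIn _) (mNum n κ) (multP n κ ε) j := by
  rw [piHat, RingQuot.liftAlgHom_mkAlgHom_apply, freeAct_T]

/-- The generator `ω` acts by `opOmega`. -/
theorem piHat_om : piHat r n κ ε (toDaha r (mNum n κ) fOm) = opOmega (qIn _) (mNum n κ) := by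
  rw [piHat, RingQuot.liftAlgHom_mkAlgHom_apply, freeAct_om]

/-- The generator `x^{m ν}` acts by multiplication. -/
theorem piHat_X (ν : Fin r → ℤ) : piHat r n κ ε (toDaha r (mNum n κ) (FreeAlgebra.ι _ (Gen.X ν))) =
    opX (mNum n κ) ν := by
  rw [piHat, RingQuot.liftAlgHom_mkAlgHom_apply, freeAct_X]

end Main

section YElements
variable (r : ℕ) [NeZero r] (m : ℕ)

/-- `T_j` is invertible in `ℍ⁽ᵐ⁾`, with inverse `T_j - k + k⁻¹`. -/
noncomputable def unitT (j : Fin r) : (Daha r m)ˣ where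
  val := toDaha r m (fT j)
  inv := toDaha r m (fT j) - algebraMap _ _ (kVar - kVar⁻¹)
  val_inv := by
    have h := RingQuot.mkAlgHom_rel BaseField (DahaRel.hecke (m := m) j)
    have hc : algebraMap BaseField (Daha r m) kVar * algebraMap BaseField (Daha r m) kVar⁻¹ = 1 := by
      rw [← map_mul, mul_inv_cancel₀ kVar_ne, map_one]
    have h1 := Algebra.commutes kVar (toDaha r m (fT j))
    rw [map_mul, map_sub, map_add, AlgHom.commutes, AlgHom.commutes, map_zero, sub_mul, mul_add,
      mul_add, hc, h1] at h
    rw [map_sub, mul_sub, mul_sub, ← sub_eq_zero, ← h]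
    abel
  inv_val := by
    have h := RingQuot.mkAlgHom_rel BaseField (DahaRel.hecke (m := m) j)
    have hc : algebraMap BaseField (Daha r m) kVar * algebraMap BaseField (Daha r m) kVar⁻¹ = 1 := by
      rw [← map_mul, mul_inv_cancel₀ kVar_ne, map_one]
    have h1 := Algebra.commutes kVar⁻¹ (toDaha r m (fT j))
    rw [map_mul, map_sub, map_add, AlgHom.commutes, AlgHom.commutes, map_zero, sub_mul, mul_add,
      mul_add, hc, ← h1] at h
    rw [map_sub, sub_mul, sub_mul, ← sub_eq_zero, ← h]
    abel

/-- `ω` as a unit of `ℍ⁽ᵐ⁾`. -/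
noncomputable def unitOmega : (Daha r m)ˣ where
  val := toDaha r m fOm
  inv := toDaha r m fOmInv
  val_inv := by rw [← map_mul, RingQuot.mkAlgHom_rel _ DahaRel.om_omInv, map_one]
  inv_val := by rw [← map_mul, RingQuot.mkAlgHom_rel _ DahaRel.omInv_om, map_one]

/-- `Y^{m ε_{i+1}} = T_i⁻¹ ⋯ T_1⁻¹ ω T_{r-1} ⋯ T_{i+1}`, for `i = 0, …, r - 1`. -/
noncomputable def unitY (i : Fin r) : (Daha r m)ˣ :=
  (((List.range' 1 i).reverse.map fun t => (unitT r m (Fin.ofNat r t))⁻¹).prod * unitOmega r m) *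
    ((List.range' (i + 1) (r - 1 - i)).reverse.map fun t => unitT r m (Fin.ofNat r t)).prod

/-- `Y^{m ν} = ∏ᵢ (Y^{m ε_i})^{ν_i}`, the factors in increasing order of `i`. -/
noncomputable def elemY (ν : Fin r → ℤ) : Daha r m :=
  ((List.ofFn fun i => unitY r m i ^ ν i).prod : (Daha r m)ˣ)

end YElements

/-- The function `σ^(n,κ)`: `k⁻¹` on the positive multiples of `m`, and `-k g_{-κ s}` elsewhere. -/
noncomputable def sigmaP (n : ℕ) (κ : ℤ) (ε : ℤˣ) (s : ℤ) : ParamField n κ ε :=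
  if 0 < s ∧ (mNum n κ : ℤ) ∣ s then (kIn _)⁻¹ else -kIn _ * gSub n κ ε (-s)

/-- The eigenvalue `(γ_μ^(n,κ))^λ` for `λ = m ν`, that is
`q^{-(λ, μ)} ∏_{i < j} σ(μ_i - μ_j)^{(λ_i - λ_j) / m}`. -/
noncomputable def gammaP {r : ℕ} (n : ℕ) (κ : ℤ) (ε : ℤˣ) (μ ν : Fin r → ℤ) : ParamField n κ ε :=
  qIn _ ^ (-∑ i, (mNum n κ * ν i) * μ i) *
    ∏ i, ∏ j ∈ Finset.Ioi i, sigmaP n κ ε (μ i - μ j) ^ (ν i - ν j)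

end Metaplectic

/-! The operators of the `Y^λ` commute, and in the monomial basis they are triangular with diagonal
entries `γ_μ^λ`; these entries tell the weights `μ` apart, and only finitely many weights lie below
a given one. For such a family, a product of factors `Y - γ_η`, one for each weight `η` below `μ`,
normalized at `μ`, sends `x^μ` to a joint eigenvector with coefficient `1` at `x^μ`. Uniqueness
holds among all Laurent polynomials: a nonzero joint eigenvector must have the eigenvalues of each
of its maximal weights (`existsUnique_joint_eigenvectors`).

Commutativity belongs to the extended affine braid group. With `Y_0 = w t_{r-1} ⋯ t_1` and `Y_{i+1}
= t_{i+1}⁻¹ Y_i t_{i+1}⁻¹`, everything reduces to `Y_0 Y_1 = Y_1 Y_0` and to the fact that `t_l`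
commutes with `Y_i` unless `l` is `i` or `i + 1`.

Triangularity is the main point (`stepTri_opT`). A single `T_j` is not triangular for the order by
`weightKey`, since the reflected monomial may be higher. The order is therefore carried along: after
each factor of the word for `Y_i`, monomials are written as `x^{μ ∘ w}`, where the permutation `w`
(the frame) changes with the factor, and they are compared through `μ`. Put `s = v_{j-1} - v_j`.
Then `T_j x^v` consists of `x^{s_j v}` and of monomials on the segment from `v` to `s_j v`, at
distances divisible by `m` from `v`. Inner points of the segment have smaller norm, and `v` itself,
when it occurs, is lower in the new frame if `w (j - 1) < w j`. The coefficient of `x^{s_j v}` is `p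
s`, except that for positive `s` divisible by `m` the geometric sum also reaches the endpoint and
`k` becomes `k - (k - k⁻¹) = k⁻¹`. This is the function `σ`. Along the word the frames start and end
at the identity, and the leading coefficients multiply to `γ` (`StepFamily.jucysMurphy`,
`gammaP_eq`).

Separation of the eigenvalues uses that `q` is independent of `k` and of the `g_s`: substituting `2
q` for `q` multiplies `γ_μ^λ` by `2^{-(λ, μ)}`, from which `μ` can be read off (`gammaP_injective`).
-/

namespace Metaplectic

/-! ### Commuting elements in the extended affine braid group of type `GL_r` -/

section AffineBraid
variable {G : Type*} [Group G] {t : ℕ → G} {w : G} {r : ℕ}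

/-- The product `t_{a+n-1} ⋯ t_{a+1} t_a`. -/
def descProd (t : ℕ → G) (a n : ℕ) : G := ((List.range' a n).reverse.map t).prod

/-- The element `t_i⁻¹ ⋯ t_1⁻¹ w t_{r-1} ⋯ t_{i+1}`. -/
def jucysMurphy (t : ℕ → G) (w : G) (r i : ℕ) : G :=
  descProd (fun j => (t j)⁻¹) 1 i * w * descProd t (i + 1) (r - 1 - i)

theorem descProd_zero (a : ℕ) : descProd t a 0 = 1 := by simp [descProd]

theorem descProd_succ (a n : ℕ) : descProd t a (n + 1) = t (a + n) * descProd t a n := by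
  simp [descProd, List.range'_concat]

theorem descProd_succ' (a n : ℕ) : descProd t a (n + 1) = descProd t (a + 1) n * t a := by
  simp [descProd, List.range'_succ]

/-- The inverse on the right cancels the last factor of the descending product and the one on the
left lengthens the string of inverses. The commutation relations below are proved by induction along
this recursion. -/
theorem jucysMurphy_succ {i : ℕ} (hi : i + 1 < r) :
    jucysMurphy t w r (i + 1) = (t (i + 1))⁻¹ * jucysMurphy t w r i * (t (i + 1))⁻¹ := by
  rw [jucysMurphy, jucysMurphy, descProd_succ, show r - 1 - i = (r - 1 - (i + 1)) + 1 by lia,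
    descProd_succ', add_comm 1 i]
  group

/-- The relations of the extended affine braid group of type `GL_r` that do not involve `t_0`. -/
structure AffineBraid (t : ℕ → G) (w : G) (r : ℕ) : Prop where
  braid : ∀ j, 1 ≤ j → j + 1 < r → t j * t (j + 1) * t j = t (j + 1) * t j * t (j + 1)
  comm : ∀ i j, 1 ≤ i → i + 1 < j → j < r → Commute (t i) (t j)
  shift : ∀ j, 1 ≤ j → j + 1 < r → w * t j = t (j + 1) * w
  wrap : w * w * t (r - 1) = t 1 * (w * w)

namespace AffineBraid

theorem commute_descProd (h : AffineBraid t w r) {a n l : ℕ} (ha : 1 ≤ a) (hl : a + n < l)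
    (hr : l < r) : Commute (descProd t a n) (t l) := by
  induction n with
  | zero => rw [descProd_zero]; exact Commute.one_left _
  | succ n ih =>
    rw [descProd_succ]
    exact (h.comm _ _ (by lia) (by lia) hr).mul_left (ih (by lia))

/-- The generator moves left past the factors of index below `l`; there `t_{l+1} t_l t_{l+1}`
becomes `t_l t_{l+1} t_l`, and the new `t_l` commutes with the factors of index above `l + 1`. -/
theorem descProd_mul (h : AffineBraid t w r) {a n l : ℕ} (ha : 1 ≤ a) (h1 : a ≤ l)
    (h2 : l + 1 < a + n) (hr : a + n ≤ r) :
    descProd t a n * t (l + 1) = t l * descProd t a n := by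
  induction n with
  | zero => lia
  | succ n ih =>
    rw [descProd_succ]
    rcases Nat.lt_or_ge (l + 1) (a + n) with h3 | h3
    · rw [mul_assoc, ih h3 (by lia), ← mul_assoc, ← mul_assoc,
        (h.comm l (a + n) (by lia) h3 (by lia)).eq]
    -- Here `l + 1` is the top index of the product, which has a second factor `t l` because `a ≤
    -- l`; this is where the braid relation is used.
    · obtain ⟨c, rfl⟩ : ∃ c, n = c + 1 := ⟨n - 1, by lia⟩
      obtain rfl : l = a + c := by lia
      rw [descProd_succ, mul_assoc, mul_assoc,
        (h.commute_descProd ha (by lia) (by lia) : Commute (descProd t a c) (t (a + c + 1))).eq,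
        ← mul_assoc, ← mul_assoc, ← add_assoc, ← h.braid _ (by lia) (by lia)]
      simp only [mul_assoc]

theorem descProd_mul_descProd (h : AffineBraid t w r) {n l c : ℕ} (hl : 1 ≤ l)
    (h2 : l + c ≤ n) (hr : n < r) :
    descProd t 1 n * descProd t (l + 1) c = descProd t l c * descProd t 1 n := by
  induction c with
  | zero => simp [descProd_zero]
  | succ c ih =>
    rw [descProd_succ, descProd_succ, ← mul_assoc, show l + 1 + c = l + c + 1 by lia,
      h.descProd_mul le_rfl (by lia) (by lia) (by lia), mul_assoc, ih (by lia), mul_assoc]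

theorem mul_descProd (h : AffineBraid t w r) {l c : ℕ} (hl : 1 ≤ l) (hr : l + c < r) :
    w * descProd t l c = descProd t (l + 1) c * w := by
  induction c with
  | zero => simp [descProd_zero]
  | succ c ih =>
    rw [descProd_succ, descProd_succ, ← mul_assoc, h.shift _ (by lia) (by lia), mul_assoc,
      ih (by lia), ← mul_assoc, show l + 1 + c = l + c + 1 by lia]

theorem jucysMurphy_zero (t : ℕ → G) (w : G) (r : ℕ) :
    jucysMurphy t w r 0 = w * descProd t 1 (r - 1) := by
  simp [jucysMurphy, descProd_zero]

/-- Passing through the descending product lowers the index of the generator by one, and passing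
through `w` raises it again. -/
theorem commute_zero (h : AffineBraid t w r) {l : ℕ} (hl : 1 < l) (hr : l < r) :
    Commute (t l) (jucysMurphy t w r 0) := by
  obtain ⟨l, rfl⟩ : ∃ c, l = c + 1 := ⟨l - 1, by lia⟩
  rw [commute_iff_eq, jucysMurphy_zero, mul_assoc, h.descProd_mul le_rfl (by lia) (by lia) (by lia),
    ← mul_assoc, ← mul_assoc, h.shift _ (by lia) hr]

/-- With `D = t_{r-1} ⋯ t_2` the two elements are `w D t_1` and `t_1⁻¹ w D`, so they commute exactly
when `t_1` commutes with `(w D)²`. Gathering both factors `w` on the left turns this into `wrap`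
together with the index shift by a descending product. (The proof replaces the rank `r` by `r + 2`.)
-/
theorem commute_zero_one (h : AffineBraid t w r) (hr : 2 ≤ r) :
    Commute (jucysMurphy t w r 0) (jucysMurphy t w r 1) := by
  obtain ⟨r, rfl⟩ : ∃ c, r = c + 2 := ⟨r - 2, by lia⟩
  rw [jucysMurphy_succ (by lia), jucysMurphy_zero, show r + 2 - 1 = r + 1 by lia, zero_add]
  have h1 : descProd t 1 (r + 1) = descProd t 2 r * t 1 := descProd_succ' 1 r
  have h2 : descProd t 1 (r + 1) = t (r + 1) * descProd t 1 r := by rw [descProd_succ, add_comm]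
  have h3 := h.descProd_mul_descProd (n := r + 1) (l := 1) (c := r) le_rfl (by lia) (by lia)
  have h4 := h.mul_descProd (l := 1) (c := r) le_rfl (by lia)
  have h5 : w * w * t (r + 1) = t 1 * (w * w) := h.wrap
  have h6 : t 1 * (w * descProd t 2 r * w * descProd t 2 r) =
      w * descProd t 2 r * w * descProd t 2 r * t 1 := by
    calc t 1 * (w * descProd t 2 r * w * descProd t 2 r)
        = t 1 * (w * (descProd t 2 r * w) * descProd t 2 r) := by simp only [mul_assoc]
      _ = t 1 * (w * w) * descProd t 1 r * descProd t 2 r := by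
        rw [← h4]; simp only [mul_assoc]
      _ = w * w * (descProd t 1 (r + 1) * descProd t (1 + 1) r) := by
        rw [← h5, h2]; simp only [mul_assoc]
      _ = w * (w * descProd t 1 r) * descProd t 2 r * t 1 := by
        rw [h3, h1]; simp only [mul_assoc]
      _ = _ := by rw [h4]; simp only [mul_assoc]
  rw [commute_iff_eq, h1]
  calc w * (descProd t 2 r * t 1) * ((t 1)⁻¹ * (w * (descProd t 2 r * t 1)) * (t 1)⁻¹)
      = w * descProd t 2 r * w * descProd t 2 r := by group
    _ = (t 1)⁻¹ * (t 1 * (w * descProd t 2 r * w * descProd t 2 r)) := by group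
    _ = _ := by rw [h6]; group

/-- By the recursion this element is built from the one of index `0` and `t_1, …, t_i`, whose
indices all differ from `l` by at least two. -/
theorem commute_of_lt (h : AffineBraid t w r) {i l : ℕ} (hl : i + 1 < l) (hr : l < r) :
    Commute (t l) (jucysMurphy t w r i) := by
  induction i with
  | zero => exact h.commute_zero (by lia) hr
  | succ i ih =>
    rw [jucysMurphy_succ (by lia)]
    have h1 := (h.comm (i + 1) l (by lia) (by lia) hr).symm.inv_right
    exact (h1.mul_right (ih (by lia))).mul_right h1

/-- Only `i = l + 1` needs an argument; larger `i` add generators far from `t_l`. In that case two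
steps of the recursion give `b⁻¹ a⁻¹ y a⁻¹ b⁻¹` with `a = t_l`, `b = t_{l+1}` and `b` commuting with
`y`. -/
theorem commute_of_gt (h : AffineBraid t w r) {i l : ℕ} (hl : 1 ≤ l) (hi : l < i) (hr : i < r) :
    Commute (t l) (jucysMurphy t w r i) := by
  induction i, hi using Nat.le_induction with
  | base =>
    obtain ⟨l, rfl⟩ : ∃ c, l = c + 1 := ⟨l - 1, by lia⟩
    rw [Nat.succ_eq_add_one, jucysMurphy_succ (by lia), jucysMurphy_succ (by lia)]
    have h1 := h.braid (l + 1) hl hr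
    have h2 := h.commute_of_lt (i := l) (l := l + 1 + 1) (by lia) hr
    generalize t (l + 1) = a at *
    generalize t (l + 1 + 1) = b at *
    generalize jucysMurphy t w r l = y at *
    -- Two forms of the braid relation: moving right through `b⁻¹ a⁻¹` the letter `a` turns into
    -- `b`, which passes `y`, and moving through `a⁻¹ b⁻¹` it turns back into `a`.
    have e1 : a * b⁻¹ * a⁻¹ = b⁻¹ * a⁻¹ * b := by
      have h3 : b * a * b⁻¹ * a⁻¹ = a⁻¹ * b := by
        calc b * a * b⁻¹ * a⁻¹ = a⁻¹ * (a * b * a) * b⁻¹ * a⁻¹ := by group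
          _ = _ := by rw [h1]; group
      calc a * b⁻¹ * a⁻¹ = b⁻¹ * (b * a * b⁻¹ * a⁻¹) := by group
        _ = _ := by rw [h3]; group
    have e2 : b * a⁻¹ * b⁻¹ = a⁻¹ * b⁻¹ * a := by
      calc b * a⁻¹ * b⁻¹ = a⁻¹ * (a * b⁻¹ * a⁻¹)⁻¹ * b⁻¹ := by group
        _ = _ := by rw [e1]; group
    rw [commute_iff_eq]
    calc a * (b⁻¹ * (a⁻¹ * y * a⁻¹) * b⁻¹) = (a * b⁻¹ * a⁻¹) * y * a⁻¹ * b⁻¹ := by group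
      _ = b⁻¹ * a⁻¹ * (b * y) * a⁻¹ * b⁻¹ := by rw [e1]; group
      _ = b⁻¹ * a⁻¹ * y * (b * a⁻¹ * b⁻¹) := by rw [h2.eq]; group
      _ = _ := by rw [e2]; group
  | succ i hi ih =>
    rw [jucysMurphy_succ (by lia)]
    have h1 := (h.comm l (i + 1) hl (by lia) hr).inv_right
    exact (h1.mul_right (ih (by lia))).mul_right h1

/-- The recursion strips generators off the element of smaller index, each of which commutes with
the other element, until that index is `0`. It then strips the larger index down to `1`, which
leaves `commute_zero_one`. -/
theorem commute_jucysMurphy_of_lt (h : AffineBraid t w r) {i j : ℕ} (hij : i < j) (hr : j < r) :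
    Commute (jucysMurphy t w r i) (jucysMurphy t w r j) := by
  induction i with
  | zero =>
    induction j, hij using Nat.le_induction with
    | base => exact h.commute_zero_one (by lia)
    | succ j hj ih =>
      rw [jucysMurphy_succ hr]
      have h1 := (h.commute_zero (by lia) hr).symm.inv_right
      exact (h1.mul_right (ih (by lia))).mul_right h1
  | succ i ih =>
    rw [jucysMurphy_succ (by lia)]
    have h1 := (h.commute_of_gt (by lia) hij hr).inv_left
    exact (h1.mul_left (ih (by lia))).mul_left h1

/-- The elements `Y_i` of an extended affine braid group commute. -/
theorem commute_jucysMurphy (h : AffineBraid t w r) {i j : ℕ} (hi : i < r) (hj : j < r) :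
    Commute (jucysMurphy t w r i) (jucysMurphy t w r j) := by
  rcases lt_trichotomy i j with hij | rfl | hij
  · exact h.commute_jucysMurphy_of_lt hij hj
  · exact Commute.refl _
  · exact (h.commute_jucysMurphy_of_lt hij hi).symm

end AffineBraid
end AffineBraid
-- The order on weights, triangularity between frames, and the Demazure-Lusztig operators
section Triangular
variable {K : Type*} [Field K] {r : ℕ}

/-- Weights are compared by their norm, and for equal norm by how far large coordinates are
to the right. -/
def weightKey (μ : Fin r → ℤ) : ℤ ×ₗ ℤ := toLex (∑ i, μ i ^ 2, ∑ i : Fin r, (i : ℤ) * μ i)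

theorem weightKey_lt_iff {η μ : Fin r → ℤ} : weightKey η < weightKey μ ↔
    ∑ i, η i ^ 2 < ∑ i, μ i ^ 2 ∨
      ∑ i, η i ^ 2 = ∑ i, μ i ^ 2 ∧ ∑ i : Fin r, (i : ℤ) * η i < ∑ i : Fin r, (i : ℤ) * μ i :=
  Prod.Lex.toLex_lt_toLex

theorem sum_sq_comp (σ : Equiv.Perm (Fin r)) (μ : Fin r → ℤ) :
    ∑ i, (μ ∘ σ) i ^ 2 = ∑ i, μ i ^ 2 :=
  Equiv.sum_comp σ fun i => μ i ^ 2

/-- The change of norm along a root string. It is negative exactly when `t` lies strictly between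
`0` and `-(v a - v b)`, that is, strictly between `v` and its reflection. -/
theorem sum_sq_add {a b : Fin r} (hab : a ≠ b) (v : Fin r → ℤ) (t : ℤ) :
    ∑ i, (v + t • (Pi.single a 1 - Pi.single b 1) : Fin r → ℤ) i ^ 2 =
      ∑ i, v i ^ 2 + 2 * t * (v a - v b + t) := by
  have h : ∀ i, (v + t • (Pi.single a 1 - Pi.single b 1) : Fin r → ℤ) i ^ 2 = v i ^ 2 +
      ((if i = a then 2 * t * v i + t ^ 2 else 0) + (if i = b then -2 * t * v i + t ^ 2 else 0)) := by
    intro i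
    simp only [Pi.add_apply, Pi.smul_apply, Pi.sub_apply, Pi.single_apply, smul_eq_mul]
    by_cases h1 : i = a
    · have h2 : i ≠ b := h1 ▸ hab
      simp only [h1 ▸ h2, h1, if_true, if_false]; ring
    · by_cases h2 : i = b
      · subst h2; simp only [h1, if_true, if_false]; ring
      · simp only [h1, h2, if_false]; ring
  simp only [h, Finset.sum_add_distrib, Finset.sum_ite_eq', Finset.mem_univ, if_true]
  ring

theorem comp_swap {a b : Fin r} (v : Fin r → ℤ) :
    v ∘ Equiv.swap a b = v + (v b - v a) • (Pi.single a 1 - Pi.single b 1) := by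
  ext i
  simp only [Function.comp_apply, Pi.add_apply, Pi.smul_apply, Pi.sub_apply, Pi.single_apply,
    smul_eq_mul, Equiv.swap_apply_def]
  split_ifs with h1 h2 h2
  · subst h1; subst h2; ring
  · subst h1; ring
  · subst h2; ring
  · ring

/-- The norm does not change, and moving the larger entry to the left changes the second component
by `(a - b) (μ b - μ a)`. -/
theorem weightKey_comp_swap_lt {a b : Fin r} (hab : a < b) {μ : Fin r → ℤ} (h : μ a < μ b) :
    weightKey (μ ∘ Equiv.swap a b) < weightKey μ := by
  refine weightKey_lt_iff.2 (Or.inr ⟨sum_sq_comp _ μ, ?_⟩)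
  have h1 : ∀ i : Fin r, (i : ℤ) * (μ ∘ Equiv.swap a b) i = (i : ℤ) * μ i +
      ((if i = a then (i : ℤ) * (μ b - μ a) else 0) -
        (if i = b then (i : ℤ) * (μ b - μ a) else 0)) := by
    intro i
    rw [comp_swap]
    simp only [Pi.add_apply, Pi.smul_apply, Pi.sub_apply, Pi.single_apply, smul_eq_mul]
    split_ifs <;> ring
  simp only [h1, Finset.sum_add_distrib, Finset.sum_sub_distrib, Finset.sum_ite_eq',
    Finset.mem_univ, if_true]
  have h2 : (a : ℤ) < b := by exact_mod_cast hab
  nlinarith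

/-- The norm bounds every coordinate, because `|x| ≤ x ^ 2` for integers. -/
theorem finite_weightKey_lt (μ : Fin r → ℤ) : {η : Fin r → ℤ | weightKey η < weightKey μ}.Finite := by
  set M := ∑ i, μ i ^ 2
  refine (Set.finite_Icc (fun _ : Fin r => -M) (fun _ => M)).subset fun η hη => ?_
  have h1 : ∑ i, η i ^ 2 ≤ M := by
    rcases weightKey_lt_iff.1 hη with h | h
    · exact h.le
    · exact h.1.le
  have h2 : ∀ i, η i ^ 2 ≤ M := fun i =>
    (Finset.single_le_sum (f := fun i => η i ^ 2) (fun i _ => sq_nonneg _)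
      (Finset.mem_univ i)).trans h1
  have h3 : ∀ x : ℤ, |x| ≤ x ^ 2 := fun x => by
    rw [← sq_abs]
    nlinarith [abs_nonneg x, Int.le_self_sq |x|]
  exact ⟨fun i => (abs_le.1 ((h3 _).trans (h2 i))).1, fun i => (abs_le.1 ((h3 _).trans (h2 i))).2⟩

/-- The lexicographic order on `ℤ × ℤ` is not well founded, but the number of weights below a given
one is finite and drops strictly, so the induction runs on that number. -/
theorem weightKey_induction {P : (Fin r → ℤ) → Prop}
    (h : ∀ μ, (∀ η, weightKey η < weightKey μ → P η) → P μ) (μ : Fin r → ℤ) : P μ := by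
  induction hn : {η : Fin r → ℤ | weightKey η < weightKey μ}.ncard using Nat.strong_induction_on
    generalizing μ with
  | _ n ih =>
    refine h μ fun η hη => ih _ ?_ η rfl
    rw [← hn]
    exact Set.ncard_lt_ncard ⟨fun ζ hζ => lt_trans hζ hη, fun hs => lt_irrefl (weightKey η) (hs hη)⟩
      (finite_weightKey_lt μ)

variable (K) in
/-- The span of the monomials `x^{η ∘ w}` with `η` lower than `μ`. -/
noncomputable def lowerSpan (w : Equiv.Perm (Fin r)) (μ : Fin r → ℤ) : Submodule K (Laurent K r) :=
  Submodule.span K ((fun η => AddMonoidAlgebra.single (η ∘ w) 1) ''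
    {η | weightKey η < weightKey μ})

theorem single_mem_lowerSpan {w : Equiv.Perm (Fin r)} {η μ : Fin r → ℤ}
    (h : weightKey η < weightKey μ) :
    (AddMonoidAlgebra.single (η ∘ w) 1 : Laurent K r) ∈ lowerSpan K w μ :=
  Submodule.subset_span ⟨η, h, rfl⟩

theorem lowerSpan_mono {w : Equiv.Perm (Fin r)} {η μ : Fin r → ℤ}
    (h : weightKey η < weightKey μ) : lowerSpan K w η ≤ lowerSpan K w μ :=
  Submodule.span_mono (Set.image_mono fun _ hζ => lt_trans hζ h)

/-- `A` maps each `x^{μ ∘ v}` to `d μ • x^{μ ∘ w}` plus a combination of lower terms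
`x^{η ∘ w}`. -/
def StepTri (A : Module.End K (Laurent K r)) (w v : Equiv.Perm (Fin r))
    (d : (Fin r → ℤ) → K) : Prop :=
  ∀ μ, A (AddMonoidAlgebra.single (μ ∘ v) 1) - d μ • AddMonoidAlgebra.single (μ ∘ w) 1 ∈
    lowerSpan K w μ

namespace StepTri
variable {A B : Module.End K (Laurent K r)} {u v w : Equiv.Perm (Fin r)} {d e : (Fin r → ℤ) → K}

theorem apply_mem (h : StepTri A w v d) {η μ : Fin r → ℤ} (hη : weightKey η < weightKey μ) :
    A (AddMonoidAlgebra.single (η ∘ v) 1) ∈ lowerSpan K w μ := by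
  have := add_mem (lowerSpan_mono hη (h η))
    ((lowerSpan K w μ).smul_mem (d η) (single_mem_lowerSpan hη))
  rwa [sub_add_cancel] at this

theorem map_mem (h : StepTri A w v d) {μ : Fin r → ℤ} {x : Laurent K r}
    (hx : x ∈ lowerSpan K v μ) : A x ∈ lowerSpan K w μ := by
  refine (Submodule.span_le (p := (lowerSpan K w μ).comap A)).2 ?_ hx
  rintro _ ⟨η, hη, rfl⟩
  exact h.apply_mem hη

theorem one : StepTri (1 : Module.End K (Laurent K r)) w w fun _ => 1 := fun μ => by simp

theorem mul (hA : StepTri A w v d) (hB : StepTri B v u e) :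
    StepTri (A * B) w u fun μ => d μ * e μ := fun μ => by
  have h1 := hA.map_mem (hB μ)
  have h2 := (lowerSpan K w μ).smul_mem (e μ) (hA μ)
  have h3 := add_mem h1 h2
  rw [map_sub, map_smul, smul_sub, smul_smul, mul_comm (e μ)] at h3
  simpa using h3

/-- Triangularity of the inverse is not automatic in infinite dimension. It holds by induction on
the order: once `A⁻¹` is triangular on all lower weights, it maps the lower span of one frame into
that of the other. -/
theorem inv {A : (Module.End K (Laurent K r))ˣ} (h : StepTri (A : Module.End K _) w v d)
    (hd : ∀ μ, d μ ≠ 0) :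
    StepTri ((A⁻¹ : (Module.End K (Laurent K r))ˣ) : Module.End K _) v w fun μ => (d μ)⁻¹ := by
  have hinv : ∀ x, (A⁻¹ : (Module.End K (Laurent K r))ˣ).1 (A.1 x) = x := fun x => by
    rw [← Module.End.mul_apply, Units.inv_mul, Module.End.one_apply]
  refine weightKey_induction fun μ ih => ?_
  have key : lowerSpan K w μ ≤ (lowerSpan K v μ).comap
      (A⁻¹ : (Module.End K (Laurent K r))ˣ).1 := by
    refine Submodule.span_le.2 ?_
    rintro _ ⟨η, hη, rfl⟩
    have := add_mem (lowerSpan_mono hη (ih η hη))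
      ((lowerSpan K v μ).smul_mem (d η)⁻¹ (single_mem_lowerSpan hη))
    rwa [sub_add_cancel] at this
  -- Applying `A⁻¹` to the lower terms of `A x^{μ ∘ v}` and scaling by `-(d μ)⁻¹` leaves exactly
  -- `A⁻¹ x^{μ ∘ w} - (d μ)⁻¹ x^{μ ∘ v}`.
  have h1 := (lowerSpan K v μ).smul_mem (-(d μ)⁻¹) (key (h μ))
  rw [map_sub, hinv, map_smul, smul_sub, smul_smul, neg_mul, inv_mul_cancel₀ (hd μ), neg_smul,
    neg_smul, sub_neg_eq_add, one_smul] at h1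
  rwa [sub_eq_neg_add]

theorem congr (h : StepTri A w v d) (hd : ∀ μ, d μ = e μ) : StepTri A w v e :=
  (funext hd : d = e) ▸ h

theorem pow {A : Module.End K (Laurent K r)} (h : StepTri A w w d) (n : ℕ) :
    StepTri (A ^ n) w w fun μ => d μ ^ n := by
  induction n with
  | zero => simpa using one
  | succ n ih => simpa only [pow_succ] using ih.mul h

theorem zpow {A : (Module.End K (Laurent K r))ˣ} (h : StepTri (A : Module.End K _) w w d)
    (hd : ∀ μ, d μ ≠ 0) (n : ℤ) :
    StepTri ((A ^ n : (Module.End K (Laurent K r))ˣ) : Module.End K _) w w fun μ => d μ ^ n := by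
  cases n with
  | ofNat n => simpa using h.pow n
  | negSucc n =>
    have := ((h.pow (n + 1)).congr (e := fun μ => d μ ^ (n + 1)) fun _ => rfl)
    rw [← Units.val_pow_eq_pow_val] at this
    simpa only [zpow_negSucc] using this.inv fun μ => pow_ne_zero _ (hd μ)

theorem list_prod {ι : Type*} {l : List ι} {A : ι → (Module.End K (Laurent K r))ˣ}
    {d : ι → (Fin r → ℤ) → K} (h : ∀ i ∈ l, StepTri (A i : Module.End K _) w w (d i)) :
    StepTri ((l.map A).prod : (Module.End K (Laurent K r))ˣ).1 w w
      fun μ => (l.map fun i => d i μ).prod := by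
  induction l with
  | nil => simpa using one
  | cons a l ih =>
    simp only [List.map_cons, List.prod_cons, Units.val_mul]
    exact (h a (by simp)).mul (ih fun i hi => h i (by simp [hi]))

end StepTri

/-- The leading coefficients of the Demazure-Lusztig operators. -/
def leadCoeff (k : K) (m : ℕ) (p : ℤ → K) (s : ℤ) : K :=
  if 0 < s ∧ (m : ℤ) ∣ s then k⁻¹ else p s

theorem leadCoeff_ne_zero {k : K} {m : ℕ} {p : ℤ → K} (hk : k ≠ 0) (hp : IsMult k m p) (s : ℤ) :
    leadCoeff k m p s ≠ 0 := by
  unfold leadCoeff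
  split_ifs
  · exact inv_ne_zero hk
  · by_cases hd : (m : ℤ) ∣ s
    · rwa [hp.dvd s hd]
    · exact left_ne_zero_of_mul_eq_one (hp.inv s hd)

/-- The norm is invariant under permutations, so a monomial of smaller norm is lower in every frame.
-/
theorem single_mem_lowerSpan_of_norm_lt {w : Equiv.Perm (Fin r)} {v μ : Fin r → ℤ}
    (h : ∑ i, v i ^ 2 < ∑ i, μ i ^ 2) :
    (AddMonoidAlgebra.single v 1 : Laurent K r) ∈ lowerSpan K w μ := by
  have h1 : weightKey (v ∘ w.symm) < weightKey μ :=
    weightKey_lt_iff.2 (Or.inl (by rwa [sum_sq_comp]))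
  have := single_mem_lowerSpan (K := K) (w := w) h1
  rwa [Function.comp_assoc, Equiv.symm_comp_self, Function.comp_id] at this

variable [NeZero r]

/-- The monomials in `T_j x^v`, `v = μ ∘ w`, lie on the segment from `v` to `s_j v`. In the new
frame the far end `s_j v` is the weight `μ` itself, the interior is lower by its norm, and the near
end `v`, which occurs in the geometric sum only for `s < 0`, is lower by the condition `hw`. -/
theorem stepTri_opT {q k : K} {m : ℕ} {p : ℤ → K} (hq : q ≠ 0) (hm : 0 < m)
    (hp : IsMult k m p) {j : Fin r} (hj : j ≠ 0) {w : Equiv.Perm (Fin r)}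
    (hw : w (j - 1) < w j) :
    StepTri (opT q k m p j) (w * Equiv.swap (j - 1) j) w
      fun μ => leadCoeff k m p (μ (w (j - 1)) - μ (w j)) := by
  intro μ
  have hne : j - 1 ≠ j := fun h => by rw [h] at hw; exact lt_irrefl _ hw
  set s := μ (w (j - 1)) - μ (w j) with hs
  set L := lowerSpan K (w * Equiv.swap (j - 1) j) μ
  have hα : ∀ v : Fin r → ℤ, ∀ t : ℤ, mono q ((v, 0) + t • simpleRoot m j) =
      AddMonoidAlgebra.single (v + t • (Pi.single (j - 1) 1 - Pi.single j 1)) 1 := by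
    intro v t; simp [mono, simpleRoot, hj]
  have hpair : pair j (μ ∘ w) = s := rfl
  have hrefl : mono q (reflect m j (μ ∘ w, 0)) =
      AddMonoidAlgebra.single (μ ∘ (w * Equiv.swap (j - 1) j)) 1 := by
    rw [reflect, sub_eq_add_neg, ← neg_smul, hα, hpair, Equiv.Perm.coe_mul, ← Function.comp_assoc,
      comp_swap, hs, neg_sub]; rfl
  -- Interior points of the segment from `v` to `s_j v = v - s • α_j`.
  have hin : ∀ t : ℤ, t * (s + t) < 0 → (AddMonoidAlgebra.single
      (μ ∘ w + t • (Pi.single (j - 1) 1 - Pi.single j 1)) 1 : Laurent K r) ∈ L := by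
    intro t ht
    apply single_mem_lowerSpan_of_norm_lt
    rw [sum_sq_add hne, sum_sq_comp]
    simp only [Function.comp_apply, ← hs]
    nlinarith
  have h0 : (AddMonoidAlgebra.single (μ ∘ w) 1 : Laurent K r) =
      mono q ((μ ∘ w, 0) : AffWeight r) := by simp [mono]
  rw [h0, opT_mono hq, hrefl]
  simp only [hα, hpair]
  have hm' : (0 : ℤ) < m := by exact_mod_cast hm
  have hdiv := Int.emod_add_mul_ediv s m
  have hr0 := Int.emod_nonneg s hm'.ne'
  have hr1 := Int.emod_lt_of_pos s hm'
  rcases lt_or_ge s 0 with hneg | hnn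
  · have hu : s / m < 0 := Int.ediv_neg_of_neg_of_pos hneg hm'
    rw [geomSum, if_neg (by lia), leadCoeff, if_neg (by lia), add_sub_cancel_right]
    refine L.smul_mem _ (L.sum_mem fun i hi => ?_)
    rw [Finset.mem_range] at hi
    -- The sum runs over `v + i m α_j` for `0 ≤ i < -⌊s / m⌋`, hence `i m < -s`: the far end is not
    -- reached, and only `i = 0` is not an interior point. For `i = 0` the monomial is that of `μ`
    -- with two entries swapped, the larger moved to the left.
    rcases Nat.eq_zero_or_pos i with rfl | hi0
    · have h1 := single_mem_lowerSpan (K := K) (w := w * Equiv.swap (j - 1) j)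
        (weightKey_comp_swap_lt hw (μ := μ) (by lia))
      have h2 : (μ ∘ Equiv.swap (w (j - 1)) (w j)) ∘ (w * Equiv.swap (j - 1) j) = μ ∘ w := by
        rw [Function.comp_assoc, ← Equiv.Perm.coe_mul, Equiv.swap_apply_apply]
        simp [mul_assoc]
      rw [h2] at h1
      simpa using h1
    · apply hin
      have h1 : (i : ℤ) + 1 ≤ -(s / m) := by lia
      have h2 : (0 : ℤ) < i := by exact_mod_cast hi0
      have h3 : (i : ℤ) * m + m ≤ -(m * (s / m)) := by nlinarith
      exact mul_neg_of_pos_of_neg (by positivity) (by lia)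
  · have hu : 0 ≤ s / m := Int.ediv_nonneg hnn hm'.le
    rw [geomSum, if_pos hu]
    obtain ⟨n, hn⟩ := Int.eq_ofNat_of_zero_le hu
    rw [hn, Int.toNat_natCast]
    -- For `s ≥ 0` the sum runs over `v - (i + 1) m α_j` with `i + 1 ≤ ⌊s / m⌋`. It omits `v`, and
    -- it reaches the far end only if `m` divides `s > 0`.
    have hin' : ∀ i : ℕ, (i + 1 : ℤ) * m < s → (AddMonoidAlgebra.single (μ ∘ w +
        (-(i + 1 : ℤ) * m) • (Pi.single (j - 1) 1 - Pi.single j 1)) 1 : Laurent K r) ∈ L := by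
      intro i hi
      apply hin
      have : (0 : ℤ) < (i + 1 : ℤ) * m := by positivity
      exact mul_neg_of_neg_of_pos (by lia) (by lia)
    by_cases hd : (m : ℤ) ∣ s
    · have hsm : s = m * (s / m) := (Int.mul_ediv_cancel' hd).symm
      rw [hp.dvd s hd]
      cases n with
      | zero =>
        have : s = 0 := by rw [hsm, hn]; simp
        rw [leadCoeff, if_neg (by lia), hp.dvd s hd]
        simp
      | succ n =>
        have hs' : s = (n + 1 : ℤ) * m := by rw [hsm, hn]; push_cast; ring
        -- The last summand is the far end; with the reflected term its coefficient is `-(k - k⁻¹) +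
        -- k = k⁻¹`, and the remaining summands are interior.
        rw [leadCoeff, if_pos ⟨by rw [← hs, hs']; positivity, hd⟩, Finset.sum_range_succ]
        have h2 : μ ∘ w + (-(n + 1 : ℤ) * m) • (Pi.single (j - 1) 1 - Pi.single j 1) =
            μ ∘ (w * Equiv.swap (j - 1) j) := by
          rw [Equiv.Perm.coe_mul, ← Function.comp_assoc, comp_swap]
          congr 2
          rw [neg_mul, ← hs', hs]; simp
        rw [h2, neg_add, smul_add, smul_neg _ (AddMonoidAlgebra.single _ _), ← neg_smul, add_assoc,
          ← add_smul, add_sub_assoc, ← sub_smul, show -(k - k⁻¹) + k - k⁻¹ = 0 by ring, zero_smul,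
          add_zero]
        refine L.smul_mem _ (L.neg_mem (L.sum_mem fun i hi => hin' i ?_))
        rw [Finset.mem_range] at hi
        rw [hs']
        have : (i : ℤ) < n := by exact_mod_cast hi
        nlinarith
    · rw [leadCoeff, if_neg (by tauto), add_sub_cancel_right]
      refine L.smul_mem _ (L.neg_mem (L.sum_mem fun i hi => hin' i ?_))
      rw [Finset.mem_range] at hi
      have h1 : (i + 1 : ℤ) ≤ s / m := by rw [hn]; exact_mod_cast hi
      -- A nonzero remainder makes `⌊s / m⌋ m < s`, so every summand is interior.
      have h2 : s % m ≠ 0 := fun h => hd (Int.dvd_of_emod_eq_zero h)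
      have h3 : 0 < s % m := lt_of_le_of_ne hr0 h2.symm
      nlinarith

/-- Since `ω` sends monomials to multiples of monomials, there are no lower terms. The power of `q`
comes from the last coordinate (index `-1`) of `μ ∘ w`. -/
theorem stepTri_opOmega (q : K) (m : ℕ) (w : Equiv.Perm (Fin r)) :
    StepTri (opOmega q m) (w * (Equiv.subRight 1 : Equiv.Perm (Fin r))) w fun μ => q ^ (-(m * μ (w (-1)))) := by
  intro μ
  have h : opOmega q m (AddMonoidAlgebra.single (μ ∘ w) 1 : Laurent K r) =
      q ^ (-(m * μ (w (-1)))) • AddMonoidAlgebra.single (μ ∘ (w * (Equiv.subRight 1 : Equiv.Perm (Fin r)))) 1 := by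
    have h0 : (AddMonoidAlgebra.single (μ ∘ w) 1 : Laurent K r) =
      mono q ((μ ∘ w, 0) : AffWeight r) := by simp [mono]
    rw [h0, opOmega, linExt_mono]
    simp [mono, omegaAct, Function.comp_def]
  rw [h, sub_self]
  exact zero_mem _

end Triangular
-- The frames and leading coefficients along the word of `Y_i`
section YOperators
variable {r : ℕ} [NeZero r]

theorem ofNat_add_one (l : ℕ) : Fin.ofNat r (l + 1) = Fin.ofNat r l + 1 := by
  simp [Fin.ext_iff, Fin.val_add, Fin.ofNat]

theorem ofNat_sub_one (l : ℕ) : Fin.ofNat r (l + 1) - 1 = Fin.ofNat r l := by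
  rw [ofNat_add_one, add_sub_cancel_right]

theorem ofNat_self : Fin.ofNat r r = 0 := by simp [Fin.ofNat]

theorem ofNat_val (i : Fin r) : Fin.ofNat r i = i := by
  simp [Fin.ofNat, Nat.mod_eq_of_lt i.2]

theorem ofNat_inj {a b : ℕ} (ha : a < r) (hb : b < r) : Fin.ofNat r a = Fin.ofNat r b ↔ a = b := by
  simp [Fin.ext_iff, Fin.ofNat, Nat.mod_eq_of_lt ha, Nat.mod_eq_of_lt hb]

theorem ofNat_lt {a b : ℕ} (h : a < b) (hb : b < r) : Fin.ofNat r a < Fin.ofNat r b := by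
  simpa [Fin.lt_def, Fin.ofNat, Nat.mod_eq_of_lt (h.trans hb), Nat.mod_eq_of_lt hb] using h

theorem swap_ofNat {a l : ℕ} (ha : a + 1 < r) (hl : l < r) :
    Equiv.swap (Fin.ofNat r a) (Fin.ofNat r (a + 1)) (Fin.ofNat r l) =
      if l = a then Fin.ofNat r (a + 1) else if l = a + 1 then Fin.ofNat r a
        else Fin.ofNat r l := by
  simp only [Equiv.swap_apply_def, ofNat_inj hl (show a < r by lia), ofNat_inj hl ha]

theorem descProd_map {G H : Type*} [Group G] [Group H] (f : G →* H) (t : ℕ → G) (a n : ℕ) :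
    f (descProd t a n) = descProd (fun j => f (t j)) a n := by
  simp [descProd, map_list_prod, Function.comp_def]

theorem jucysMurphy_map {G H : Type*} [Group G] [Group H] (f : G →* H) (t : ℕ → G) (w : G)
    (r i : ℕ) : f (jucysMurphy t w r i) = jucysMurphy (fun j => f (t j)) (f w) r i := by
  simp [jucysMurphy, descProd_map]

variable {K : Type*} [Field K] {t : ℕ → (Module.End K (Laurent K r))ˣ} {σ : ℤ → K}

/-- The operators `t_l`, `0 < l < r`, act triangularly with leading coefficients given by `σ`. -/
def StepFamily (t : ℕ → (Module.End K (Laurent K r))ˣ) (σ : ℤ → K) : Prop :=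
  ∀ l, l + 1 < r → ∀ w : Equiv.Perm (Fin r), w (Fin.ofNat r l) < w (Fin.ofNat r (l + 1)) →
    StepTri (t (l + 1)).1 (w * Equiv.swap (Fin.ofNat r l) (Fin.ofNat r (l + 1))) w
      fun μ => σ (μ (w (Fin.ofNat r l)) - μ (w (Fin.ofNat r (l + 1))))

/-- The entry `μ_i` is carried to the right past `μ_{i+1}, …, μ_{i+n}`, one neighbour for each
generator, and each passage contributes one factor `σ`. The explicit cycle `w` records where the
entries stand. -/
theorem StepFamily.descProd (h : StepFamily t σ) (i n : ℕ) (hn : i + n < r) :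
    ∃ w : Equiv.Perm (Fin r),
      (∀ l < r, w (Fin.ofNat r l) = Fin.ofNat r (if l < i then l else if l < i + n then l + 1
        else if l = i + n then i else l)) ∧
      StepTri (Metaplectic.descProd t (i + 1) n).1 w 1
        fun μ => ∏ l ∈ Finset.range n, σ (μ (Fin.ofNat r i) - μ (Fin.ofNat r (i + 1 + l))) := by
  induction n with
  | zero =>
    refine ⟨1, fun l hl => ?_, ?_⟩
    · rw [Equiv.Perm.one_apply]; congr 1; split_ifs <;> lia
    · rw [descProd_zero]; simpa using StepTri.one
  | succ n ih =>
    obtain ⟨w, hw, hs⟩ := ih (by lia)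
    have e1 := hw (i + n) (by lia)
    have e2 := hw (i + n + 1) (by lia)
    rw [if_neg (by lia), if_neg (by lia), if_pos rfl] at e1
    rw [if_neg (by lia), if_neg (by lia), if_neg (by lia)] at e2
    refine ⟨w * Equiv.swap (Fin.ofNat r (i + n)) (Fin.ofNat r (i + n + 1)), fun l hl => ?_, ?_⟩
    · rw [Equiv.Perm.mul_apply, swap_ofNat (by lia) hl]
      split_ifs with h1 h2
      all_goals first
        | lia
        | (rw [e1])
        | (rw [hw l hl]; congr 1; split_ifs <;> lia)
    -- The next generator compares the positions holding the indices `i` and `i + n + 1`; these are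
    -- in increasing order, as `StepFamily` requires.
    · have h1 := h (i + n) (by lia) w (by rw [e1, e2]; exact ofNat_lt (by lia) (by lia))
      rw [descProd_succ, show i + 1 + n = i + n + 1 by lia, Units.val_mul]
      refine (h1.mul hs).congr fun μ => ?_
      rw [Finset.prod_range_succ, mul_comm, e1, e2, show i + 1 + n = i + n + 1 by lia]

/-- `StepFamily` describes the generators only in the direction `w (l) < w (l + 1)`, so the factor
`t_i⁻¹ ⋯ t_1⁻¹`, which has to end in frame `1`, is treated through its inverse `t_1 ⋯ t_i`, which
starts there. That product carries `μ_{a+n}` to the left past `μ_{a+n-1}, …, μ_a`. The induction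
varies `a` because the factor applied last is the one of lowest index. -/
theorem StepFamily.descProd_inv (h : StepFamily t σ) (a n : ℕ) (hn : a + n < r) :
    ∃ w : Equiv.Perm (Fin r),
      (∀ l < r, w (Fin.ofNat r l) = Fin.ofNat r (if l < a then l else if l = a then a + n
        else if l ≤ a + n then l - 1 else l)) ∧
      StepTri (Metaplectic.descProd (fun j => (t j)⁻¹) (a + 1) n)⁻¹.1 w 1
        fun μ => ∏ l ∈ Finset.range n, σ (μ (Fin.ofNat r (a + l)) - μ (Fin.ofNat r (a + n))) := by
  induction n generalizing a with
  | zero =>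
    refine ⟨1, fun l hl => ?_, ?_⟩
    · rw [Equiv.Perm.one_apply]; congr 1; split_ifs <;> lia
    · rw [descProd_zero]; simpa using StepTri.one
  | succ n ih =>
    obtain ⟨w, hw, hs⟩ := ih (a + 1) (by lia)
    have e1 := hw a (by lia)
    have e2 := hw (a + 1) (by lia)
    rw [if_pos (by lia)] at e1
    rw [if_neg (by lia), if_pos rfl] at e2
    refine ⟨w * Equiv.swap (Fin.ofNat r a) (Fin.ofNat r (a + 1)), fun l hl => ?_, ?_⟩
    · rw [Equiv.Perm.mul_apply, swap_ofNat (by lia) hl]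
      split_ifs with h1 h2
      all_goals first
        | lia
        | (rw [e1]; congr 1; lia)
        | (rw [hw l hl]; congr 1; split_ifs <;> lia)
    · have h1 := h a (by lia) w (by rw [e1, e2]; exact ofNat_lt (by lia) (by lia))
      rw [descProd_succ', mul_inv_rev, inv_inv, Units.val_mul]
      refine (h1.mul hs).congr fun μ => ?_
      rw [Finset.prod_range_succ', mul_comm, e1, e2, add_zero, add_assoc, add_comm 1 n]
      congr 1
      refine Finset.prod_congr rfl fun l _ => ?_
      rw [show a + 1 + l = a + (l + 1) by lia]

theorem prod_range_ofNat (f : Fin r → K) (i : Fin r) :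
    ∏ l ∈ Finset.range i, f (Fin.ofNat r l) = ∏ j ∈ Finset.Iio i, f j := by
  refine Finset.prod_bij' (fun l _ => Fin.ofNat r l) (fun j _ => j.val) ?_ ?_ ?_ ?_ ?_
  · intro l hl
    rw [Finset.mem_range] at hl
    have := ofNat_lt hl i.2
    rwa [ofNat_val, ← Finset.mem_Iio] at this
  · intro j hj
    simpa using hj
  · intro l hl
    rw [Finset.mem_range] at hl
    simp [Fin.ofNat, Nat.mod_eq_of_lt (hl.trans i.2)]
  · intro j _
    exact ofNat_val j
  · intros; rfl

theorem prod_range_ofNat_add (f : Fin r → K) (i : Fin r) :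
    ∏ l ∈ Finset.range (r - 1 - i), f (Fin.ofNat r (i + 1 + l)) = ∏ j ∈ Finset.Ioi i, f j := by
  refine Finset.prod_bij' (fun l _ => Fin.ofNat r (i + 1 + l)) (fun j _ => j.val - (i + 1))
    ?_ ?_ ?_ ?_ ?_
  · intro l hl
    rw [Finset.mem_range] at hl
    have := ofNat_lt (r := r) (a := i) (b := i + 1 + l) (by lia) (by lia)
    rwa [ofNat_val, ← Finset.mem_Ioi] at this
  · intro j hj
    have h1 : i.val < j.val := by simpa using hj
    have h2 := j.2
    rw [Finset.mem_range]; lia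
  · intro l hl
    rw [Finset.mem_range] at hl
    simp [Fin.ofNat, Nat.mod_eq_of_lt (show i.val + 1 + l < r by lia)]
  · intro j hj
    have h1 : i.val < j.val := by simpa using hj
    rw [show i.val + 1 + (j.val - (i.val + 1)) = j.val by lia, ofNat_val]
  · intros; rfl

/-- The operators `Y_i` are triangular. -/
theorem StepFamily.jucysMurphy (h : StepFamily t σ) (hσ : ∀ s, σ s ≠ 0) {q : K} {m : ℕ}
    {ω : (Module.End K (Laurent K r))ˣ} (hω : ω.1 = opOmega q m) (i : Fin r) :
    StepTri (Metaplectic.jucysMurphy t ω r i).1 1 1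
      fun μ => (∏ j ∈ Finset.Iio i, σ (μ j - μ i))⁻¹ *
        (q ^ (-(m * μ i)) * ∏ j ∈ Finset.Ioi i, σ (μ i - μ j)) := by
  have hi := i.2
  obtain ⟨w, hw, hs⟩ := h.descProd i (r - 1 - i) (by lia)
  obtain ⟨u, hu, hs'⟩ := h.descProd_inv 0 i (by lia)
  have hr : (-1 : Fin r) = Fin.ofNat r (r - 1) := by
    rw [← ofNat_sub_one, Nat.sub_add_cancel (by lia), ofNat_self, zero_sub]
  have hw1 : w (-1) = i := by
    rw [hr, hw _ (by lia), if_neg (by lia), if_neg (by lia), if_pos (by lia), ofNat_val]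
  -- The frame `w` has `μ_i` in last place and the other entries in order. The rotation by `ω`
  -- brings `μ_i` to the front, which is the frame `u` from which `t_i⁻¹ ⋯ t_1⁻¹` leads back to the
  -- identity.
  have huw : w * (Equiv.subRight 1 : Equiv.Perm (Fin r)) = u := by
    refine Equiv.ext fun x => ?_
    rw [Equiv.Perm.mul_apply, Equiv.subRight_apply, ← ofNat_val x]
    have hx := x.2
    generalize x.val = l at hx
    cases l with
    | zero =>
      rw [hu 0 (by lia), if_neg (by lia), if_pos rfl, zero_add, ofNat_val]
      have : Fin.ofNat r 0 = 0 := by simp [Fin.ofNat]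
      rw [this, zero_sub, hw1]
    | succ l =>
      rw [ofNat_sub_one, hw _ (by lia), hu _ hx]
      congr 1
      split_ifs <;> lia
  have h1 := stepTri_opOmega q m w
  rw [huw, ← hω] at h1
  have h2 := hs'.inv fun μ => Finset.prod_ne_zero_iff.2 fun l _ => hσ _
  rw [inv_inv] at h2
  rw [Metaplectic.jucysMurphy, Units.val_mul, Units.val_mul, mul_assoc]
  refine (h2.mul (h1.mul hs)).congr fun μ => ?_
  simp only [zero_add, ofNat_val, hw1]
  rw [← prod_range_ofNat (fun j => σ (μ j - μ i)), ← prod_range_ofNat_add (fun j => σ (μ i - μ j))]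

end YOperators

/-! ### Commutativity of the `Y^λ` in the double affine Hecke algebra -/

section DahaBraid
variable (r : ℕ) [NeZero r] (m : ℕ)

theorem affineBraid_daha (hr : 2 ≤ r) :
    AffineBraid (fun t => unitT r m (Fin.ofNat r t)) (unitOmega r m) r := by
  have hom : ∀ j : Fin r, unitOmega r m * unitT r m j = unitT r m (j + 1) * unitOmega r m := by
    intro j
    have := RingQuot.mkAlgHom_rel BaseField (DahaRel.om_T (m := m) j)
    rw [map_mul, map_mul] at this
    exact Units.ext this
  refine ⟨fun j h1 h2 => ?_, fun i j h1 h2 h3 => ?_, fun j h1 h2 => ?_, ?_⟩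
  · have := RingQuot.mkAlgHom_rel BaseField (DahaRel.braid (m := m) (by lia) (Fin.ofNat r j))
    simp only [map_mul, ← ofNat_add_one] at this
    exact Units.ext this
  -- Commutation in the algebra requires nonadjacency modulo `r`. For `j = r - 1` the cyclic
  -- neighbour `j + 1` is `0`, which is excluded by `1 ≤ i`.
  · have h4 : Fin.ofNat r i ≠ Fin.ofNat r (j + 1) := by
      rcases Nat.lt_or_ge (j + 1) r with h | h
      · rw [Ne, ofNat_inj (by lia) h]; lia
      · rw [show j + 1 = r by lia, ofNat_self]
        have : (0 : Fin r) = Fin.ofNat r 0 := by simp [Fin.ofNat]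
        rw [this, Ne, ofNat_inj (by lia) (by lia)]; lia
    have := RingQuot.mkAlgHom_rel BaseField (DahaRel.comm (m := m) (Fin.ofNat r i) (Fin.ofNat r j)
      (by rw [Ne, ofNat_inj (by lia) (by lia)]; lia) (by rwa [← ofNat_add_one])
      (by rw [← ofNat_add_one, Ne, ofNat_inj (by lia) (by lia)]; lia))
    simp only [map_mul] at this
    exact Units.ext this
  · rw [hom, ofNat_add_one]
  -- The relation `wrap` is `ω T_{r-1} = T_0 ω` followed by `ω T_0 = T_1 ω`.
  · have h0 : Fin.ofNat r (r - 1) + 1 = 0 := by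
      rw [← ofNat_add_one, Nat.sub_add_cancel (by lia), ofNat_self]
    have h1 : Fin.ofNat r 1 = 0 + 1 := by
      rw [← zero_add 1, ofNat_add_one]; simp [Fin.ofNat]
    rw [mul_assoc, hom, ← mul_assoc, h0, hom, ← mul_assoc, h1]

theorem unitY_eq (i : Fin r) :
    unitY r m i = jucysMurphy (fun t => unitT r m (Fin.ofNat r t)) (unitOmega r m) r i := rfl

theorem commute_unitY (hr : 2 ≤ r) (i j : Fin r) : Commute (unitY r m i) (unitY r m j) :=
  (affineBraid_daha r m hr).commute_jucysMurphy i.2 j.2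

theorem commute_elemY (hr : 2 ≤ r) (ν ν' : Fin r → ℤ) :
    Commute (elemY r m ν) (elemY r m ν') := by
  refine Commute.units_val ?_
  refine Commute.list_prod_left _ _ fun x hx => Commute.list_prod_right _ _ fun y hy => ?_
  obtain ⟨i, rfl⟩ := (List.mem_ofFn' _ _).1 hx
  obtain ⟨j, rfl⟩ := (List.mem_ofFn' _ _).1 hy
  exact (commute_unitY r m hr i j).zpow_zpow _ _

end DahaBraid

/-! ### The diagonal entries of the `Y^λ` are the `γ_μ^λ` -/

section Triangularity
variable {r n : ℕ} [NeZero n] {κ : ℤ} {ε : ℤˣ}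

/-- By definition `sigmaP` is `leadCoeff` for the multiplicity function `multP`. -/
theorem sigmaP_ne_zero (s : ℤ) : sigmaP n κ ε s ≠ 0 :=
  leadCoeff_ne_zero kIn_ne (isMult_multP (NeZero.pos n)) s

/-- For a pair `i < j` the factor `σ(μ_i - μ_j)` occurs in the entry of `Y_i` and, inverted, in that
of `Y_j`; together they give the exponent `ν_i - ν_j`. -/
theorem gammaP_eq (μ ν : Fin r → ℤ) : ∏ i, ((∏ j ∈ Finset.Iio i, sigmaP n κ ε (μ j - μ i))⁻¹ *
      (qIn (ParamField n κ ε) ^ (-(mNum n κ * μ i)) *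
        ∏ j ∈ Finset.Ioi i, sigmaP n κ ε (μ i - μ j))) ^ ν i = gammaP n κ ε μ ν := by
  have h1 : ∀ i, ∏ j ∈ Finset.Ioi i, sigmaP n κ ε (μ i - μ j) ^ (ν i - ν j) =
      (∏ j ∈ Finset.Ioi i, sigmaP n κ ε (μ i - μ j)) ^ ν i /
        ∏ j ∈ Finset.Ioi i, sigmaP n κ ε (μ i - μ j) ^ ν j := by
    intro i
    rw [← Finset.prod_zpow, ← Finset.prod_div_distrib]
    exact Finset.prod_congr rfl fun j _ => zpow_sub₀ (sigmaP_ne_zero _) _ _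
  have h2 : ∏ i, ∏ j ∈ Finset.Ioi i, sigmaP n κ ε (μ i - μ j) ^ ν j =
      ∏ j, ∏ i ∈ Finset.Iio j, sigmaP n κ ε (μ i - μ j) ^ ν j :=
    Finset.prod_comm' (by simp)
  have h3 : qIn (ParamField n κ ε) ^ (-∑ i, (mNum n κ * ν i) * μ i) =
      ∏ i, (qIn (ParamField n κ ε) ^ (-(mNum n κ * μ i))) ^ ν i := by
    rw [← Finset.sum_neg_distrib]
    have h4 : ∀ s : Finset (Fin r), qIn (ParamField n κ ε) ^ (∑ i ∈ s, -((mNum n κ * ν i) * μ i)) =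
        ∏ i ∈ s, (qIn (ParamField n κ ε) ^ (-(mNum n κ * μ i))) ^ ν i := fun s => by
      induction s using Finset.cons_induction with
      | empty => simp
      | cons a s ha ih =>
        rw [Finset.sum_cons, Finset.prod_cons, zpow_add₀ qIn_ne, ih, ← zpow_mul]
        congr 2; ring
    exact h4 _
  rw [gammaP, h3, Finset.prod_congr rfl fun i _ => h1 i, Finset.prod_div_distrib, h2]
  simp only [mul_zpow, inv_zpow, Finset.prod_mul_distrib, Finset.prod_inv_distrib,
    Finset.prod_zpow]
  rw [div_eq_mul_inv]
  ring

theorem gammaP_ne_zero (μ ν : Fin r → ℤ) : gammaP n κ ε μ ν ≠ 0 :=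
  mul_ne_zero (zpow_ne_zero _ qIn_ne) (Finset.prod_ne_zero_iff.2 fun _ _ =>
    Finset.prod_ne_zero_iff.2 fun _ _ => zpow_ne_zero _ (sigmaP_ne_zero _))

variable [r.AtLeastTwo]

variable (r n κ ε) in
theorem stepFamily_piHat :
    StepFamily (fun t => Units.map (MonoidHomClass.toMonoidHom (piHat r n κ ε)) (unitT r (mNum n κ) (Fin.ofNat r t)))
      (sigmaP n κ ε) := by
  intro l hl w hw
  change StepTri (piHat r n κ ε (toDaha r (mNum n κ) (fT (Fin.ofNat r (l + 1))))) _ _ _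
  rw [piHat_T]
  -- The words of the `Y_i` involve only `T_1, …, T_{r-1}`, so the affine root with its powers of
  -- `q` does not enter.
  have h0 : Fin.ofNat r (l + 1) ≠ 0 := by
    simp [Fin.ext_iff, Fin.ofNat, Nat.mod_eq_of_lt hl]
  have := stepTri_opT (K := ParamField n κ ε) (p := multP n κ ε) qIn_ne (mNum_pos (NeZero.pos n))
    (isMult_multP (NeZero.pos n)) h0 (w := w) (by rwa [ofNat_sub_one])
  rwa [ofNat_sub_one] at this

/-- The operators of the `Y^λ` are triangular, with the eigenvalues `γ_μ^λ` on the diagonal. -/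
theorem stepTri_elemY (ν : Fin r → ℤ) :
    StepTri (piHat r n κ ε (elemY r (mNum n κ) ν)) 1 1 fun μ => gammaP n κ ε μ ν := by
  set Φ : (Daha r (mNum n κ))ˣ →* _ := Units.map (MonoidHomClass.toMonoidHom (piHat r n κ ε)) with hΦ
  have hσ := sigmaP_ne_zero (n := n) (κ := κ) (ε := ε)
  have h1 : ∀ i, StepTri (Φ (unitY r (mNum n κ) i)).1 1 1 _ := fun i => by
    rw [unitY_eq, jucysMurphy_map]
    exact (stepFamily_piHat r n κ ε).jucysMurphy hσ
      (q := qIn (ParamField n κ ε)) (m := mNum n κ) (piHat_om r n κ ε) i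
  have h2 := StepTri.list_prod (l := List.finRange r) fun i _ => (h1 i).zpow (fun μ =>
    mul_ne_zero (inv_ne_zero (Finset.prod_ne_zero_iff.2 fun _ _ => hσ _))
      (mul_ne_zero (zpow_ne_zero _ qIn_ne) (Finset.prod_ne_zero_iff.2 fun _ _ => hσ _))) (ν i)
  have h3 : (((List.finRange r).map fun i => Φ (unitY r (mNum n κ) i) ^ ν i).prod).1 =
      piHat r n κ ε (elemY r (mNum n κ) ν) := by
    change _ = (Φ (List.ofFn fun i => unitY r (mNum n κ) i ^ ν i).prod).1
    rw [map_list_prod, List.map_ofFn, List.ofFn_eq_map]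
    simp only [Function.comp_def, map_zpow]
  rw [h3] at h2
  refine h2.congr fun μ => ?_
  rw [← List.ofFn_eq_map, List.prod_ofFn, gammaP_eq]

end Triangularity
-- Joint eigenvectors of commuting triangular operators
section JointEigenvectors
variable {K : Type*} [Field K] {r : ℕ}

/-- Different weights can have the same key. The negated inequality covers such ties as well as `μ =
η`, so ties produce no off-diagonal entries. -/
theorem coeff_of_mem_lowerSpan {η μ : Fin r → ℤ} (h : ¬ weightKey μ < weightKey η)
    {x : Laurent K r} (hx : x ∈ lowerSpan K 1 η) : x.coeff μ = 0 := by
  induction hx using Submodule.span_induction with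
  | mem x hx =>
    obtain ⟨ζ, hζ, rfl⟩ := hx
    rw [AddMonoidAlgebra.coeff_single, Finsupp.single_apply, if_neg]
    rintro rfl
    exact h hζ
  | zero => simp
  | add x y _ _ hx hy => rw [AddMonoidAlgebra.coeff_add, Finsupp.add_apply, hx, hy, add_zero]
  | smul c x _ hx => rw [AddMonoidAlgebra.coeff_smul_apply, hx, smul_zero]

theorem StepTri.smul_sub {A : Module.End K (Laurent K r)} {w : Equiv.Perm (Fin r)}
    {d : (Fin r → ℤ) → K} (h : StepTri A w w d) (c g : K) :
    StepTri (c • (A - g • 1)) w w fun μ => c * (d μ - g) := fun μ => by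
  have h1 := (lowerSpan K w μ).smul_mem c (h μ)
  convert h1 using 1
  simp only [LinearMap.smul_apply, LinearMap.sub_apply, Module.End.one_apply]
  module

variable {I : Type*} {Y : I → Module.End K (Laurent K r)} {γ : (Fin r → ℤ) → I → K}

/-- Commuting triangular operators with separated diagonals: a polynomial in these operators that
kills the monomials in a given finite lower set and fixes another monomial up to lower terms. -/
theorem exists_annihilator (htri : ∀ i, StepTri (Y i) 1 1 fun μ => γ μ i)
    (hcomm : ∀ i j, Commute (Y i) (Y j)) (hsep : ∀ η μ, (∀ i, γ η i = γ μ i) → η = μ)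
    (μ : Fin r → ℤ) (s : Finset (Fin r → ℤ))
    (hs : ∀ η ∈ s, ∀ ζ, weightKey ζ < weightKey η → ζ ∈ s) (hμ : μ ∉ s) :
    ∃ Q : Module.End K (Laurent K r), (∀ i, Commute Q (Y i)) ∧
      (∃ d, StepTri Q 1 1 d ∧ d μ = 1) ∧ ∀ η ∈ s, Q (AddMonoidAlgebra.single η 1) = 0 := by
  classical
  induction s using Finset.induction_on_max_value weightKey with
  | empty => exact ⟨1, fun i => Commute.one_left _, ⟨_, StepTri.one, rfl⟩, by simp⟩
  | insert a s ha hmax ih =>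
    have hs' : ∀ η ∈ s, ∀ ζ, weightKey ζ < weightKey η → ζ ∈ s := fun η hη ζ hζ => by
      refine (Finset.mem_insert.1 (hs η (Finset.mem_insert_of_mem hη) ζ hζ)).resolve_left ?_
      rintro rfl
      exact lt_irrefl _ (hζ.trans_le (hmax η hη))
    have ha' : ∀ ζ, weightKey ζ < weightKey a → ζ ∈ s := fun ζ hζ => by
      refine (Finset.mem_insert.1 (hs a (Finset.mem_insert_self a s) ζ hζ)).resolve_left ?_
      rintro rfl
      exact lt_irrefl _ hζ
    rw [Finset.mem_insert, not_or] at hμ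
    obtain ⟨Q, hQ, ⟨d, hd, hdμ⟩, hk⟩ := ih hs' hμ.2
    obtain ⟨i, hi⟩ : ∃ i, γ a i ≠ γ μ i := by
      by_contra! h
      exact hμ.1 (hsep a μ h).symm
    -- The new factor annihilates `x^a` up to lower terms and has diagonal entry `1` at `μ`. Applied
    -- first, it sends each `x^η` with `η` in the enlarged set to a multiple of `x^η`, with factor
    -- zero for `η = a`, plus lower terms; `Q` kills all that remains.
    refine ⟨Q * ((γ μ i - γ a i)⁻¹ • (Y i - γ a i • 1)), fun j => ?_,
      ⟨_, hd.mul ((htri i).smul_sub _ _), ?_⟩, fun η hη => ?_⟩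
    · exact (hQ j).mul_left (((hcomm i j).sub_left
        ((Commute.one_left (Y j)).smul_left _)).smul_left _)
    · rw [hdμ, inv_mul_cancel₀ (sub_ne_zero.2 (Ne.symm hi)), mul_one]
    · have hlow : ∀ ζ, (∀ ξ, weightKey ξ < weightKey ζ → ξ ∈ s) →
          lowerSpan K 1 ζ ≤ LinearMap.ker Q := fun ζ hζ => by
        refine Submodule.span_le.2 ?_
        rintro _ ⟨ξ, hξ, rfl⟩
        exact hk ξ (hζ ξ hξ)
      -- All weights below `η` are in `s`: for `η = a` because the enlarged set is a lower set,
      -- otherwise because `s` itself is one, `a` having maximal key.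
      have h1 : Q (Y i (AddMonoidAlgebra.single η 1) - γ η i • AddMonoidAlgebra.single η 1) = 0 := by
        refine hlow η ?_ (htri i η)
        rcases Finset.mem_insert.1 hη with rfl | h
        · exact ha'
        · exact hs' η h
      rw [map_sub, sub_eq_zero, map_smul] at h1
      rw [Module.End.mul_apply, LinearMap.smul_apply, LinearMap.sub_apply, map_smul, map_sub, h1,
        LinearMap.smul_apply, Module.End.one_apply, map_smul]
      rcases Finset.mem_insert.1 hη with rfl | h
      · rw [sub_self, smul_zero]
      · rw [hk η h, smul_zero, smul_zero, sub_zero, smul_zero]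

/-- Let `Q` kill all monomials below `μ` and take `E = Q x^μ`. Since `Q` commutes with `Y_i`, one
has `Y_i E = Q (γ x^μ + lower terms) = γ E`. -/
theorem exists_joint_eigenvector (htri : ∀ i, StepTri (Y i) 1 1 fun μ => γ μ i)
    (hcomm : ∀ i j, Commute (Y i) (Y j)) (hsep : ∀ η μ, (∀ i, γ η i = γ μ i) → η = μ)
    (μ : Fin r → ℤ) :
    ∃ E : Laurent K r, (∀ i, Y i E = γ μ i • E) ∧ E.coeff μ = 1 := by
  obtain ⟨Q, hQ, ⟨d, hd, hdμ⟩, hk⟩ := exists_annihilator htri hcomm hsep μ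
    (finite_weightKey_lt μ).toFinset
    (fun η hη ζ hζ => by
      rw [Set.Finite.mem_toFinset] at hη ⊢
      exact lt_trans hζ hη)
    (by simp)
  refine ⟨Q (AddMonoidAlgebra.single μ 1), fun i => ?_, ?_⟩
  · have hlow : lowerSpan K 1 μ ≤ LinearMap.ker Q := by
      refine Submodule.span_le.2 ?_
      rintro _ ⟨ξ, hξ, rfl⟩
      exact hk ξ (by simpa using hξ)
    have h1 : Q (Y i (AddMonoidAlgebra.single μ 1) - γ μ i • AddMonoidAlgebra.single μ 1) = 0 :=
      hlow (htri i μ)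
    rw [map_sub, sub_eq_zero, map_smul] at h1
    rw [← h1, ← Module.End.mul_apply, ← Module.End.mul_apply, (hQ i).eq]
  · have h1 := coeff_of_mem_lowerSpan (lt_irrefl _) (hd μ)
    rw [hdμ, one_smul, AddMonoidAlgebra.coeff_sub, Finsupp.sub_apply, sub_eq_zero] at h1
    refine h1.trans ?_
    simp

/-- At a weight `a` of maximal key in the support of `D`, no other term of `D` contributes to the
coefficient of `x^a` in `Y_i D`. Hence `γ_a = γ_μ`, so `a = μ`, where the coefficient vanishes. No
triangularity of `D` with respect to `μ` is needed. -/
theorem eq_zero_of_joint_eigenvector (htri : ∀ i, StepTri (Y i) 1 1 fun μ => γ μ i)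
    (hsep : ∀ η μ, (∀ i, γ η i = γ μ i) → η = μ) {μ : Fin r → ℤ} {D : Laurent K r}
    (hD : ∀ i, Y i D = γ μ i • D) (h0 : D.coeff μ = 0) : D = 0 := by
  by_contra hne
  obtain ⟨a, ha, hmax⟩ := Finset.exists_max_image D.coeff.support weightKey
    (Finsupp.support_nonempty_iff.2 fun h => hne (AddMonoidAlgebra.coeff_eq_zero.1 h))
  have hsum : D = ∑ ζ ∈ D.coeff.support, D.coeff ζ • AddMonoidAlgebra.single ζ 1 := by
    refine AddMonoidAlgebra.coeff_injective ?_
    rw [AddMonoidAlgebra.coeff_sum]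
    simp only [AddMonoidAlgebra.smul_single, smul_eq_mul, mul_one, AddMonoidAlgebra.coeff_single]
    exact D.coeff.sum_single.symm
  have hcoeff : ∀ i, (Y i D).coeff a = γ a i * D.coeff a := fun i => by
    have h1 : ∀ ζ ∈ D.coeff.support, (Y i (AddMonoidAlgebra.single ζ 1)).coeff a =
        γ a i * (AddMonoidAlgebra.single ζ 1 : Laurent K r).coeff a := fun ζ hζ => by
      have h2 := coeff_of_mem_lowerSpan (not_lt.2 (hmax ζ hζ)) (htri i ζ)
      rw [AddMonoidAlgebra.coeff_sub, Finsupp.sub_apply, sub_eq_zero,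
        AddMonoidAlgebra.coeff_smul_apply, smul_eq_mul] at h2
      refine h2.trans ?_
      change γ ζ i * (AddMonoidAlgebra.single ζ 1 : Laurent K r).coeff a = _
      rw [AddMonoidAlgebra.coeff_single, Finsupp.single_apply]
      split_ifs with h
      · rw [h]
      · rw [mul_zero, mul_zero]
    conv_lhs => rw [hsum]
    conv_rhs => rw [hsum]
    simp only [map_sum, map_smul, AddMonoidAlgebra.coeff_sum, Finsupp.finsetSum_apply,
      AddMonoidAlgebra.coeff_smul_apply, Finset.mul_sum]
    refine Finset.sum_congr rfl fun ζ hζ => ?_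
    rw [h1 ζ hζ, smul_eq_mul, smul_eq_mul, mul_left_comm]
  have ha0 := Finsupp.mem_support_iff.1 ha
  have : a = μ := hsep a μ fun i => by
    have h1 := hcoeff i
    rw [hD, AddMonoidAlgebra.coeff_smul_apply, smul_eq_mul] at h1
    exact (mul_right_cancel₀ ha0 h1).symm
  exact ha0 (this ▸ h0)

/-- Commuting triangular operators with separated diagonals have a unique monic joint
eigenbasis. -/
theorem existsUnique_joint_eigenvectors (htri : ∀ i, StepTri (Y i) 1 1 fun μ => γ μ i)
    (hcomm : ∀ i j, Commute (Y i) (Y j)) (hsep : ∀ η μ, (∀ i, γ η i = γ μ i) → η = μ) :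
    ∃! E : (Fin r → ℤ) → Laurent K r,
      ∀ μ, (∀ i, Y i (E μ) = γ μ i • E μ) ∧ (E μ).coeff μ = 1 := by
  choose E hE using exists_joint_eigenvector htri hcomm hsep
  refine ⟨E, hE, fun F hF => funext fun μ => sub_eq_zero.1 ?_⟩
  refine eq_zero_of_joint_eigenvector htri hsep (μ := μ) (fun i => ?_) ?_
  · rw [map_sub, (hF μ).1, (hE μ).1, smul_sub]
  · rw [AddMonoidAlgebra.coeff_sub, Finsupp.sub_apply, (hF μ).2, (hE μ).2, sub_self]

end JointEigenvectors

/-! ### The eigenvalues separate the weights -/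

section Separation

instance : CharZero BaseField :=
  (algebraMap (MvPolynomial (Fin 2) ℂ) BaseField).charZero_iff
    (IsFractionRing.injective (MvPolynomial (Fin 2) ℂ) BaseField) |>.1 inferInstance

/-- Doubling `q` is an injective endomorphism of `ℂ[q, k]`. -/
theorem exists_scale_polynomial : ∃ f : MvPolynomial (Fin 2) ℂ →+* MvPolynomial (Fin 2) ℂ,
    Function.Injective f ∧ f (MvPolynomial.X 0) = 2 * MvPolynomial.X 0 ∧
      f (MvPolynomial.X 1) = MvPolynomial.X 1 := by
  let g (c : ℂ) : MvPolynomial (Fin 2) ℂ →ₐ[ℂ] MvPolynomial (Fin 2) ℂ :=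
    MvPolynomial.aeval ![MvPolynomial.C c * MvPolynomial.X 0, MvPolynomial.X 1]
  -- Halving `q` is a left inverse. Injectivity is what allows the map to extend to the fraction
  -- field.
  have h : (g 2⁻¹).comp (g 2) = AlgHom.id ℂ _ := by
    refine MvPolynomial.algHom_ext fun i => ?_
    fin_cases i
    · have hc : (MvPolynomial.C 2 * MvPolynomial.C 2⁻¹ : MvPolynomial (Fin 2) ℂ) = 1 := by
        rw [← map_mul, mul_inv_cancel₀ two_ne_zero, map_one]
      simp only [g, AlgHom.comp_apply, MvPolynomial.aeval_X, AlgHom.id_apply, Fin.zero_eta,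
        Matrix.cons_val_zero, map_mul, MvPolynomial.algHom_C, MvPolynomial.algebraMap_eq]
      rw [← mul_assoc, hc, one_mul]
    · simp [g]
  refine ⟨g 2, Function.LeftInverse.injective (g := g 2⁻¹) fun x => AlgHom.congr_fun h x, ?_, ?_⟩
  · exact (MvPolynomial.aeval_X _ 0).trans (by simp only [Matrix.cons_val_zero, map_ofNat])
  · simp [g]

theorem exists_scale_baseField : ∃ f : BaseField →+* BaseField,
    f qVar = 2 * qVar ∧ f kVar = kVar := by
  obtain ⟨f, hf, h0, h1⟩ := exists_scale_polynomial
  refine ⟨IsFractionRing.map hf, ?_, ?_⟩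
  · rw [qVar, IsFractionRing.map, IsLocalization.map_eq, h0, map_mul, map_ofNat]
  · rw [kVar, IsFractionRing.map, IsLocalization.map_eq, h1]

/-- Doubling `q` is an endomorphism of `𝕂⁽ⁿ⁾` that fixes the `g_s`. -/
theorem exists_scale_bigField (n : ℕ) : ∃ f : BigField n →+* BigField n,
    f (algebraMap BaseField (BigField n) qVar) = 2 * algebraMap BaseField (BigField n) qVar ∧
    f (algebraMap BaseField (BigField n) kVar) = algebraMap BaseField (BigField n) kVar ∧
    ∀ ε s, f (gParam n ε s) = gParam n ε s := by
  obtain ⟨f, h0, h1⟩ := exists_scale_baseField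
  have hf := MvPolynomial.map_injective (σ := {j : ℕ // 1 ≤ j ∧ 2 * j < n}) f f.injective
  let F : BigField n →+* BigField n := IsFractionRing.map hf
  have hF : ∀ x : MvPolynomial {j : ℕ // 1 ≤ j ∧ 2 * j < n} BaseField,
      F (algebraMap _ (BigField n) x) = algebraMap _ (BigField n) (MvPolynomial.map f x) :=
    fun x => IsLocalization.map_eq _ x
  have hF' : ∀ c, F (algebraMap BaseField (BigField n) c) = algebraMap _ (BigField n) (f c) := by
    intro c
    rw [IsScalarTower.algebraMap_apply BaseField
      (MvPolynomial {j : ℕ // 1 ≤ j ∧ 2 * j < n} BaseField) (BigField n), hF,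
      MvPolynomial.algebraMap_eq, MvPolynomial.map_C,
      IsScalarTower.algebraMap_apply BaseField
      (MvPolynomial {j : ℕ // 1 ≤ j ∧ 2 * j < n} BaseField) (BigField n), MvPolynomial.algebraMap_eq]
  have hk : F (algebraMap BaseField (BigField n) kVar) = algebraMap BaseField (BigField n) kVar := by
    rw [hF', h1]
  have hg : ∀ j, F (gVar n j) = gVar n j := fun j => by
    unfold gVar
    split_ifs
    · rw [hF, MvPolynomial.map_X]
    · rw [map_zero]
  refine ⟨F, ?_, hk, fun ε s => ?_⟩
  · rw [hF', h0, map_mul, map_ofNat]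
  -- Each value of `g_s` is an expression in `k`, the sign and the variables `g_j`, in which `q`
  -- does not occur.
  · simp only [gParam]
    split_ifs
    · rw [map_neg, map_one]
    · exact hg _
    · rw [map_mul, map_intCast, map_inv₀, hk]
    · rw [map_mul, map_inv₀, map_pow, hk, map_inv₀, hg]

/-- Both powers lie in the prime field `ℚ`, where the order shows that `z ↦ 2 ^ z` is injective. -/
theorem two_zpow_injective {L : Type*} [Field L] [CharZero L] {a b : ℤ}
    (h : (2 : L) ^ a = 2 ^ b) : a = b := by
  have h1 : (2 : ℚ) ^ a = 2 ^ b := by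
    apply Rat.cast_injective (α := L)
    push_cast
    exact h
  exact zpow_right_injective₀ (by norm_num) (by norm_num) h1

variable {n r : ℕ} [NeZero n] {κ : ℤ} {ε : ℤˣ}

/-- The eigenvalues separate the weights, because `q` is independent of `k` and the `g_s`. -/
theorem gammaP_injective {η μ : Fin r → ℤ} (h : ∀ ν, gammaP n κ ε η ν = gammaP n κ ε μ ν) :
    η = μ := by
  obtain ⟨f, hq, hk, hg⟩ := exists_scale_bigField n
  have : CharZero (BigField n) :=
    charZero_of_injective_algebraMap (algebraMap BaseField (BigField n)).injective
  let ι : ParamField n κ ε →+* BigField n := algebraMap (paramSubfield n κ ε) (BigField n)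
  have hq' : f (ι (qIn _)) = 2 * ι (qIn _) := hq
  have hk' : f (ι (kIn _)) = ι (kIn _) := hk
  have hg' : ∀ s, f (ι (gSub n κ ε s)) = ι (gSub n κ ε s) := fun s => hg ε _
  have hσ : ∀ s, f (ι (sigmaP n κ ε s)) = ι (sigmaP n κ ε s) := fun s => by
    unfold sigmaP
    split_ifs
    · rw [map_inv₀, map_inv₀, hk']
    · rw [map_mul, map_mul, map_neg, map_neg, hk', hg']
  -- The values of `σ` are fixed by the substitution, so only the power of `q` in `γ` changes. The
  -- map `f` acts on the big field, hence the embedding `ι`.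
  have hγ : ∀ μ ν : Fin r → ℤ, f (ι (gammaP n κ ε μ ν)) =
      2 ^ (-∑ i, (mNum n κ * ν i) * μ i) * ι (gammaP n κ ε μ ν) := fun μ ν => by
    simp only [gammaP, map_mul, map_zpow₀, map_prod, hσ, hq', mul_zpow, mul_assoc]
  ext i
  -- Taking `λ = m ε_i` makes the exponent of `2` equal to `-m μ_i`; cancelling the nonzero
  -- eigenvalue and then `m` recovers the coordinate.
  have h1 := congrArg (fun x => f (ι x)) (h (Pi.single i 1))
  simp only [hγ] at h1
  rw [h (Pi.single i 1)] at h1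
  have h2 := two_zpow_injective (mul_right_cancel₀ ((map_ne_zero ι).2 (gammaP_ne_zero _ _)) h1)
  simp only [Pi.single_apply, mul_ite, ite_mul, mul_one, mul_zero, zero_mul, Finset.sum_ite_eq',
    Finset.mem_univ, if_true, neg_inj] at h2
  have h3 := mNum_pos (κ := κ) (NeZero.pos n)
  exact mul_left_cancel₀ (by exact_mod_cast h3.ne') h2

end Separation
end Metaplectic

theorem mainTheorem9 (r n : ℕ) [r.AtLeastTwo] [NeZero n] (κ : ℤ) (hκ : κ ≠ 0) (ε : ℤˣ) :
    ∃! E : (Fin r → ℤ) → Metaplectic.Laurent (Metaplectic.ParamField n κ ε) r,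
      ∀ μ : Fin r → ℤ,
        (∀ ν : Fin r → ℤ,
          Metaplectic.piHat r n κ ε (Metaplectic.elemY r (Metaplectic.mNum n κ) ν) (E μ) =
            Metaplectic.gammaP n κ ε μ ν • E μ) ∧
        (E μ).coeff μ = 1 :=
  Metaplectic.existsUnique_joint_eigenvectors Metaplectic.stepTri_elemY
    (fun ν ν' => (Metaplectic.commute_elemY r _ Nat.AtLeastTwo.prop ν ν').map
      (Metaplectic.piHat r n κ ε))
    fun _ _ => Metaplectic.gammaP_injective
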